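/- Let $m\ge 1$, let $I\subset\mathbb R$ be a non-empty open interval, let $(F_i,g_{F_i})$, $1\le i\le m$, be non-empty smooth pseudo-Riemannian manifolds of dimensions $l_i\ge 1$, and let $b_i:I\to(0,\infty)$ be smooth. Let $M=I\times F_1\times\dots\times F_m$ with the metric $g=-dt^2\oplus b_1^2g_{F_1}\oplus\dots\oplus b_m^2g_{F_m}$, let $\overline n=\dim M=1+\sum_i l_i>2$, and let $\nabla$ be the Levi-Civita connection of $g$. Fix $r\in\{1,\dots,m\}$ and a smooth vector field $P$ on $F_r$ with $g_{F_r}(P,P)=1$, lifted to $M$; put $\pi(X)=g(X,P)$. Fix real numbers $\lambda_1\ne0$, $\lambda_2\ne0$, and let $$\overline\nabla_XY=\nabla_XY+\lambda_1\pi(Y)X-\lambda_2g(X,Y)P .$$ For a connection $D$, curvature is $R(X,Y)Z=D_XD_YZ-D_YD_XZ-D_{[X,Y]}Z$ and $\mathrm{Ric}(X,Y)=\sum_k\varepsilon_k\, g(R(X,E_k)Y,E_k)$ for an orthonormal basis $(E_k)$ with $\varepsilon_k=g(E_k,E_k)=\pm1$. "Einstein with constant $\alpha$" means $\mathrm{Ric}(X,Y)=\alpha\,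 g(X,Y)$ for all $X,Y$ with a real constant $\alpha$; for $(M,\overline\nabla)$ the Ricci tensor is that of $\overline\nabla$, and for $F_i$ that of the Levi-Civita connection $\nabla^{F_i}$. Let $\mathrm{div}_{F_r}P=\sum_k\varepsilon_k\, g_{F_r}(\nabla^{F_r}_{E_k}P,E_k)$ over an orthonormal basis $(E_k)$ of $TF_r$. Theorem 4.12. For every $\alpha\in\mathbb R$, $(M,\overline\nabla)$ is Einstein with constant $\alpha$ if and only if there are real constants $\alpha_i$ ($i\neq r$), $\mu_0$, $\mu_1$ such that: 1. for every $i\ne r$, $(F_i,\nabla^{F_i})$ is Einstein with constant $\alpha_i$; 2. $b_r$ is constant, $\sum_{i=1}^m l_i\frac{b_i''}{b_i}=\mu_0$ on $I$, $\mathrm{div}_{F_r}P=\mu_1$ on $F_r$, and $\mu_0-\lambda_2\mu_1+\alpha=[(\overline n-1)\lambda_1\lambda_2-\lambda_2^2]\,b_r^2$; 3. with $\overline\alpha=b_r^2\{[(\overline n-1)\lambda_1\lambda_2-\lambda_2^2]b_r^2+\lambda_2\mu_1-\alpha\}$, for all $V,W$ tangent to $F_r$, $$\mathrm{Ric}^{F_r}(V,W)+\overline\alpha\,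 g_{F_r}(V,W)=[(\overline n-1)\lambda_1^2-\lambda_2^2]\,\pi(V)\pi(W)-[(\overline n-1)\lambda_1-\lambda_2]\,g(W,\nabla_VP);$$ 4. for every $i\neq r$, on $I$, $$\alpha_i-b_ib_i''+[(\overline n-1)\lambda_1\lambda_2-\lambda_2^2]\,b_i^2b_r^2-b_ib_i'\sum_{s\ne i}l_s\frac{b_s'}{b_s}-(l_i-1)(b_i')^2=(\alpha-\lambda_2\mu_1)\,b_i^2 .$$ -/

import Mathlib

open scoped Manifold ContDiff

noncomputable section

namespace QuarterSymmetric

/-! ### Linear connections in local coordinates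

Coordinates take values in a finite-dimensional real vector space `E`.  A linear connection is given
by its coefficients `Γ y u v`, so that `∇_X Y = DY(X) + Γ(X, Y)` for vector fields `X`, `Y`. -/

section Local

variable {E : Type*} [NormedAddCommGroup E] [NormedSpace ℝ E]

/-- The covariant derivative `∇_X Y` at `y` for the connection with coefficients `Γ`. -/
def covDeriv (Γ : E → E → E → E) (X Y : E → E) (y : E) : E :=
  fderiv ℝ Y y (X y) + Γ y (X y) (Y y)

/-- The curvature `R(X, Y) Z = ∇_X ∇_Y Z - ∇_Y ∇_X Z - ∇_[X, Y] Z` at `y`. -/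
def curvature (Γ : E → E → E → E) (X Y Z : E → E) (y : E) : E :=
  covDeriv Γ X (covDeriv Γ Y Z) y - covDeriv Γ Y (covDeriv Γ X Z) y
    - covDeriv Γ (VectorField.lieBracket ℝ X Y) Z y

/-- The trace of a linear endomorphism of `E`, as the sum of its diagonal entries in a basis. For a
nondegenerate symmetric form `g` with orthonormal basis `E_k`, `ε_k = g(E_k, E_k) = ±1`, it equals
`∑ k, ε_k g(A E_k, E_k)`. -/
def traceOf [FiniteDimensional ℝ E] (A : E → E) : ℝ :=
  ∑ k, (Module.finBasis ℝ E).repr (A (Module.finBasis ℝ E k)) k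

/-- The Ricci tensor `Ric(u, v) = ∑ k, ε_k g(R(u, E_k) v, E_k)`, that is the trace of
`e ↦ R(u, e) v`, of the connection with coefficients `Γ`; the vectors are extended by the vector
fields that are constant in the coordinates. -/
def ricciLocal [FiniteDimensional ℝ E] (Γ : E → E → E → E) (y u v : E) : ℝ :=
  traceOf fun e => curvature Γ (fun _ => u) (fun _ => e) (fun _ => v) y

/-- The Christoffel symbols of a (pseudo-Riemannian) metric `G` in coordinates:
`2 G(Γ(u, v), w) = D_u G(v, w) + D_v G(u, w) - D_w G(u, v)`. -/
def christoffel (G : E → E →L[ℝ] E →L[ℝ] ℝ) (y u v : E) : E :=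
  (G y).inverse ((1 / 2 : ℝ) •
    (fderiv ℝ G y u v + fderiv ℝ G y v u - ((fderiv ℝ G y).flip u).flip v))

/-- The coefficients of the connection
`∇̄_X Y = ∇_X Y + lam₁ π(Y) X - lam₂ g(X, Y) P`, where `π(Y) = g(Y, P)` and `∇` is the Levi-Civita
connection of the metric `G`. -/
def quarterCoeff (lam₁ lam₂ : ℝ) (G : E → E →L[ℝ] E →L[ℝ] ℝ) (P : E → E) (y u v : E) : E :=
  christoffel G y u v + (lam₁ * G y v (P y)) • u - (lam₂ * G y u v) • P y

end Local

/-! ### Manifolds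

Tensors on a manifold (without boundary) are computed in charts. Recall that `TangentSpace J x` is
identified with `E` through the preferred chart at `x`, so tensors at `x` are evaluated in that
chart, on the same vectors. -/

section Manifold

variable {E : Type*} [NormedAddCommGroup E] [NormedSpace ℝ E]
  {H : Type*} [TopologicalSpace H] (J : ModelWithCorners ℝ E H)
  {M : Type*} [TopologicalSpace M] [ChartedSpace H M]

/-- A field of bilinear forms on the tangent spaces. -/
abbrev MetricField (J : ModelWithCorners ℝ E H) (M : Type*) [TopologicalSpace M]
    [ChartedSpace H M] : Type _ :=
  ∀ x : M, TangentSpace J x →L[ℝ] TangentSpace J x →L[ℝ] ℝ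

/-- The derivative at `z` of the change of coordinates from the preferred chart at `x` to the one
at `x'`. With `x' = z` it sends the components of a tangent vector at `z` in the chart at `x` to
that tangent vector; with `x = z` it sends a tangent vector at `z` to its components in the chart at
`x'`. -/
def coordChange (x x' z : M) : E →L[ℝ] E :=
  fderivWithin ℝ (extChartAt J x' ∘ (extChartAt J x).symm) (Set.range J) (extChartAt J x z)

/-- The components of `g` in the preferred chart at `x₀`, as a function of the coordinates. -/
def coordMetric (g : MetricField J M) (x₀ : M) (y : E) : E →L[ℝ] E →L[ℝ] ℝ :=
  let z : M := (extChartAt J x₀).symm y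
  ContinuousLinearMap.bilinearComp (E := E) (F := E) (g z)
    (coordChange J x₀ z z) (coordChange J x₀ z z)

/-- The components of the vector field `P` in the preferred chart at `x₀`. -/
def coordField (P : ∀ x : M, TangentSpace J x) (x₀ : M) (y : E) : E :=
  let z : M := (extChartAt J x₀).symm y
  coordChange J z x₀ z (P z)

/-- `g` is a smooth pseudo-Riemannian metric. -/
structure IsPseudoRiemannian (g : MetricField J M) : Prop where
  symm : ∀ (x : M) (v w : TangentSpace J x), g x v w = g x w v
  nondegenerate : ∀ (x : M) (v : TangentSpace J x), (∀ w, g x v w = 0) → v = 0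
  smooth : ∀ x₀ : M, ContDiffOn ℝ ∞ (coordMetric J g x₀) (extChartAt J x₀).target

/-- The covariant derivative `∇_v P` at `x` for the Levi-Civita connection `∇` of `g`. -/
def nabla (g : MetricField J M) (P : ∀ x : M, TangentSpace J x) (x : M) (v : TangentSpace J x) :
    TangentSpace J x :=
  covDeriv (E := E) (christoffel (coordMetric J g x)) (fun _ => v) (coordField J P x) (extChartAt J x x)

variable [FiniteDimensional ℝ E]

/-- The divergence `div P = ∑ k, ε_k g(∇_{E_k} P, E_k)`. -/
def divergence (g : MetricField J M) (P : ∀ x : M, TangentSpace J x) (x : M) : ℝ :=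
  traceOf (E := E) fun v => nabla J g P x v

/-- The Ricci tensor of the Levi-Civita connection of `g`. -/
def ricci (g : MetricField J M) (x : M) (u v : TangentSpace J x) : ℝ :=
  ricciLocal (christoffel (coordMetric J g x)) (extChartAt J x x) u v

/-- The Ricci tensor of the connection
`∇̄_X Y = ∇_X Y + lam₁ g(Y, P) X - lam₂ g(X, Y) P`. -/
def ricciBar (lam₁ lam₂ : ℝ) (g : MetricField J M) (P : ∀ x : M, TangentSpace J x) (x : M)
    (u v : TangentSpace J x) : ℝ :=
  ricciLocal (quarterCoeff lam₁ lam₂ (coordMetric J g x) (coordField J P x)) (extChartAt J x x) u v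

end Manifold

/-! ### Multiply warped products over an interval -/

section Warped

variable {m : ℕ} {l : Fin m → ℕ} {F : Fin m → Type*} [∀ i, TopologicalSpace (F i)]
  [∀ i, ChartedSpace (EuclideanSpace ℝ (Fin (l i))) (F i)]

/-- The model with corners of `I × F₁ × ⋯ × F_m`, where `F i` has dimension `l i`. -/
abbrev warpedModel (l : Fin m → ℕ) :
    ModelWithCorners ℝ (ℝ × ∀ i, EuclideanSpace ℝ (Fin (l i)))
      (ModelProd ℝ (ModelPi fun i => EuclideanSpace ℝ (Fin (l i)))) :=
  𝓘(ℝ, ℝ).prod (ModelWithCorners.pi fun i => 𝓡 (l i))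

/-- The metric `-dt² ⊕ b₁² g₁ ⊕ ⋯ ⊕ b_m² g_m` on `I × F₁ × ⋯ × F_m`. -/
def warpedMetric (I : TopologicalSpace.Opens ℝ) (b : Fin m → ℝ → ℝ)
    (gF : ∀ i, MetricField (𝓡 (l i)) (F i)) :
    MetricField (warpedModel l) (I × ∀ i, F i) := fun x =>
  ((-(ContinuousLinearMap.mul ℝ ℝ).bilinearComp (ContinuousLinearMap.fst ℝ ℝ _)
        (ContinuousLinearMap.fst ℝ ℝ _)
      + ∑ i, (b i x.1) ^ 2 • ContinuousLinearMap.bilinearComp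
          (E := EuclideanSpace ℝ (Fin (l i))) (F := EuclideanSpace ℝ (Fin (l i))) (gF i (x.2 i))
          ((ContinuousLinearMap.proj i).comp (ContinuousLinearMap.snd ℝ ℝ _))
          ((ContinuousLinearMap.proj i).comp (ContinuousLinearMap.snd ℝ ℝ _))) :
    (ℝ × ∀ i, EuclideanSpace ℝ (Fin (l i))) →L[ℝ]
      (ℝ × ∀ i, EuclideanSpace ℝ (Fin (l i))) →L[ℝ] ℝ)

/-- The lift to `T_x M`, for `x` in `M = I × F₁ × ⋯ × F_m`, of a tangent vector of `F r`. -/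
def liftVec {I : TopologicalSpace.Opens ℝ} (r : Fin m) (x : I × ∀ i, F i)
    (v : TangentSpace (𝓡 (l r)) (x.2 r)) : TangentSpace (warpedModel l) x :=
  ((0, Pi.single r v) : ℝ × ∀ i, EuclideanSpace ℝ (Fin (l i)))

/-- The lift to `I × F₁ × ⋯ × F_m` of a vector field on `F r`. -/
def liftField (I : TopologicalSpace.Opens ℝ) (r : Fin m)
    (P : ∀ p : F r, TangentSpace (𝓡 (l r)) p) (x : I × ∀ i, F i) :
    TangentSpace (warpedModel l) x :=
  liftVec r x (P (x.2 r))

end Warped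

end QuarterSymmetric

end

open scoped Manifold ContDiff

noncomputable section

namespace QuarterSymmetric

open Filter Topology

/-! ### Traces of endomorphisms -/

section Trace

variable {E : Type*} [NormedAddCommGroup E] [NormedSpace ℝ E] [FiniteDimensional ℝ E]

/-! Write n for the dimension, K = (n-1)λ₁ - λ₂ and L = (n-1)λ₁λ₂ - λ₂² = λ₂K. The difference of the
two connections is an algebraic tensor built from `g` and `P`, and `g` is parallel, so the Ricci
tensor of the new connection is that of the Levi-Civita connection plus terms in ∇P, div P and π
(`ricciLocal_quarterCoeff`). Combined with the Ricci tensor of a multiply warped product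
(`IsWarpedAt.ricciLocal_eq`) and the covariant derivative of a lifted field, this expresses
everything through the fibers (`ricciBar_warped`). Since all these quantities depend only on germs
in a chart, the computation takes place in a vector space and is then carried to the manifold.

Testing on pairs of directions splits the Einstein equation into four (`ricciBar_warped_eq_iff`): a
time-time equation, the mixed equation K b_r b_r' = 0, one equation for each fiber other than F_r,
and one for F_r. At a fixed time the first shows that div P is constant, as λ₂ ≠ 0. For i ≠ r, the
Ricci tensor of F_i is g_i times a function of t, which must be constant.

The delicate point is that b_r is constant. If K ≠ 0, this is the mixed equation. If K = 0, then L =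
0 while (n-1)λ₁² - λ₂² = -(n-1)(n-2)λ₁² is nonzero because n > 2. Evaluating the F_r equation on (P,
P) then gives ordinary differential equations for the b_i with a nonzero source along F_r only. A
contracted Bianchi argument (`sum_mul_eq_zero_of_field_equations`) is incompatible with this source
unless b_r' = 0. Once b_r is constant, the four equations are the stated conditions, and the
converse is substitution.

The Ricci tensor here is the trace of e ↦ R(u, e)v, the negative of the most common convention; this
governs the signs throughout. -/

theorem traceOf_add (A B : E → E) :
    traceOf (fun e => A e + B e) = traceOf A + traceOf B := by
  simp [traceOf, Finset.sum_add_distrib]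

theorem traceOf_sub (A B : E → E) :
    traceOf (fun e => A e - B e) = traceOf A - traceOf B := by
  simp [traceOf, Finset.sum_sub_distrib]

theorem traceOf_smul (c : ℝ) (A : E → E) :
    traceOf (fun e => c • A e) = c * traceOf A := by
  simp [traceOf, Finset.mul_sum]

theorem traceOf_smul_id (c : ℝ) :
    traceOf (fun e : E => c • e) = c * Module.finrank ℝ E := by
  simp [traceOf, mul_comm]

/-- Contractions of tensor terms in the curvature reduce to this: each vector other than the traced
one contributes a rank-one endomorphism. -/
theorem traceOf_rankOne (φ : E →ₗ[ℝ] ℝ) (w : E) : traceOf (fun e => φ e • w) = φ w := by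
  conv_rhs => rw [← (Module.finBasis ℝ E).sum_repr w]
  rw [map_sum]
  simp [traceOf, mul_comm]

theorem traceOf_eq_trace (A : E →ₗ[ℝ] E) : traceOf A = LinearMap.trace ℝ E A := by
  rw [LinearMap.trace_eq_matrix_trace ℝ (Module.finBasis ℝ E), Matrix.trace]
  simp [traceOf, LinearMap.toMatrix_apply]

/-- The trace does not depend on the basis, so it can be computed in one adapted to the product;
only the diagonal blocks of `A` then matter. -/
theorem traceOf_prod_pi {ι : Type*} [Fintype ι] [DecidableEq ι] {V : ι → Type*}
    [∀ i, NormedAddCommGroup (V i)] [∀ i, NormedSpace ℝ (V i)] [∀ i, FiniteDimensional ℝ (V i)]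
    {A : (ℝ × ∀ i, V i) → (ℝ × ∀ i, V i)} (hA : IsLinearMap ℝ A) :
    traceOf A = (A (1, 0)).1 + ∑ i, traceOf fun e => (A (0, Pi.single i e)).2 i := by
  have h := traceOf_eq_trace (hA.mk' A)
  change traceOf A = _ at h
  rw [h, LinearMap.trace_eq_matrix_trace ℝ
    ((Module.Basis.singleton Unit ℝ).prod (Pi.basis fun i => Module.finBasis ℝ (V i))),
    Matrix.trace]
  simp [traceOf, LinearMap.toMatrix_apply, Fintype.sum_sum_type, Fintype.sum_sigma]

end Trace

/-! ### Curvature on constant vector fields -/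

section Curvature

variable {E : Type*} [NormedAddCommGroup E] [NormedSpace ℝ E]

/-- Constant fields commute, so the bracket term is the connection in the direction 0, which `hΓ`
makes vanish. -/
theorem curvature_const {Γ : E → E → E → E} {y : E} (hΓ : ∀ v, Γ y 0 v = 0) (u e v : E) :
    curvature Γ (fun _ => u) (fun _ => e) (fun _ => v) y
      = (fderiv ℝ (fun z => Γ z e v) y u + Γ y u (Γ y e v))
        - (fderiv ℝ (fun z => Γ z u v) y e + Γ y e (Γ y u v)) := by
  have h (e : E) : covDeriv Γ (fun _ => e) (fun _ => v) = fun z => Γ z e v := by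
    ext z; simp [covDeriv]
  simp only [curvature, h]
  simp [covDeriv, VectorField.lieBracket, hΓ]

theorem curvature_congr {Γ Γ' : E → E → E → E} {y : E} (h : ∀ᶠ z in 𝓝 y, Γ z = Γ' z)
    (hΓ : ∀ v, Γ y 0 v = 0) (u e v : E) :
    curvature Γ (fun _ => u) (fun _ => e) (fun _ => v) y
      = curvature Γ' (fun _ => u) (fun _ => e) (fun _ => v) y := by
  have h0 := h.self_of_nhds
  have hd (e : E) : fderiv ℝ (fun z => Γ z e v) y = fderiv ℝ (fun z => Γ' z e v) y :=
    Filter.EventuallyEq.fderiv_eq (h.mono fun z hz => by simp only [hz])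
  rw [curvature_const hΓ, curvature_const (by simpa [← h0] using hΓ), ← h0, hd, hd]

end Curvature

/-! ### The Levi-Civita connection in coordinates -/

section Christoffel

variable {E : Type*} [NormedAddCommGroup E] [NormedSpace ℝ E]

/-- Near `y`, the field `G` of bilinear forms is a smooth pseudo-Riemannian metric. -/
structure IsMetricAt (G : E → E →L[ℝ] E →L[ℝ] ℝ) (y : E) : Prop where
  symm : ∀ᶠ z in 𝓝 y, ∀ v w, G z v w = G z w v
  nondegenerate : ∀ᶠ z in 𝓝 y, ∀ v, (∀ w, G z v w = 0) → v = 0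
  smooth : ∀ᶠ z in 𝓝 y, ContDiffAt ℝ ∞ G z

variable {G : E → E →L[ℝ] E →L[ℝ] ℝ} {y : E}

theorem IsMetricAt.eventually (h : IsMetricAt G y) : ∀ᶠ z in 𝓝 y, IsMetricAt G z := by
  filter_upwards [h.symm.eventually_nhds, h.nondegenerate.eventually_nhds,
    h.smooth.eventually_nhds] with z h₁ h₂ h₃ using ⟨h₁, h₂, h₃⟩

theorem IsMetricAt.differentiableAt (h : IsMetricAt G y) : DifferentiableAt ℝ G y :=
  h.smooth.self_of_nhds.differentiableAt (by simp)

theorem fderiv_apply_apply (hG : DifferentiableAt ℝ G y) (u v w : E) :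
    fderiv ℝ (fun z => G z v w) y u = fderiv ℝ G y u v w := by
  have h := (hG.hasFDerivAt.clm_apply (hasFDerivAt_const v y)).clm_apply (hasFDerivAt_const w y)
  rw [h.fderiv]
  simp

theorem IsMetricAt.fderiv_symm (h : IsMetricAt G y) (u v w : E) :
    fderiv ℝ G y u v w = fderiv ℝ G y u w v := by
  rw [← fderiv_apply_apply h.differentiableAt, ← fderiv_apply_apply h.differentiableAt]
  exact congrArg (fun L : E →L[ℝ] ℝ => L u)
    (Filter.EventuallyEq.fderiv_eq (h.symm.mono fun z hz => hz v w))

theorem christoffel_add_left (u u' v : E) :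
    christoffel G y (u + u') v = christoffel G y u v + christoffel G y u' v := by
  simp only [christoffel, ← map_add]
  congr 1
  ext w
  simp
  ring

theorem christoffel_smul_left (c : ℝ) (u v : E) :
    christoffel G y (c • u) v = c • christoffel G y u v := by
  simp only [christoffel, ← map_smul]
  congr 1
  ext w
  simp
  ring

theorem christoffel_add_right (u v v' : E) :
    christoffel G y u (v + v') = christoffel G y u v + christoffel G y u v' := by
  simp only [christoffel, ← map_add]
  congr 1
  ext w
  simp
  ring

theorem christoffel_smul_right (c : ℝ) (u v : E) :
    christoffel G y u (c • v) = c • christoffel G y u v := by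
  simp only [christoffel, ← map_smul]
  congr 1
  ext w
  simp
  ring

theorem christoffel_zero_left (v : E) : christoffel G y 0 v = 0 := by
  simpa using christoffel_smul_left (G := G) (y := y) 0 0 v

theorem christoffel_zero_right (v : E) : christoffel G y v 0 = 0 := by
  simpa using christoffel_smul_right (G := G) (y := y) 0 v 0

variable [FiniteDimensional ℝ E]

/-- `ContinuousLinearMap.inverse` is zero on non-invertible maps; in finite dimension, nondegeneracy
ensures that `christoffel` uses a genuine inverse. -/
theorem exists_equiv_of_nondegenerate (L : E →L[ℝ] E →L[ℝ] ℝ) (hL : ∀ v, (∀ w, L v w = 0) → v = 0) :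
    ∃ e : E ≃L[ℝ] (E →L[ℝ] ℝ), (e : E →L[ℝ] E →L[ℝ] ℝ) = L := by
  have hinj : Function.Injective (L : E →ₗ[ℝ] E →L[ℝ] ℝ) := by
    rw [injective_iff_map_eq_zero]
    exact fun v hv => hL v fun w => by simpa using congrArg (fun f => f w) hv
  have hdim : Module.finrank ℝ E = Module.finrank ℝ (E →L[ℝ] ℝ) := by
    rw [← (LinearMap.toContinuousLinearMap (𝕜 := ℝ) (E := E) (F' := ℝ)).finrank_eq]
    exact (Subspace.dual_finrank_eq).symm
  refine ⟨(LinearMap.linearEquivOfInjective _ hinj hdim).toContinuousLinearEquiv, ?_⟩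
  ext v w
  simp

theorem christoffel_koszul (hG : ∀ v, (∀ w, G y v w = 0) → v = 0) (u v w : E) :
    G y (christoffel G y u v) w
      = (1 / 2) * (fderiv ℝ G y u v w + fderiv ℝ G y v u w - fderiv ℝ G y w u v) := by
  obtain ⟨e, he⟩ := exists_equiv_of_nondegenerate (G y) hG
  rw [christoffel, ← he, ContinuousLinearMap.inverse_equiv]
  simp

/-- Nondegeneracy makes the solution of the Koszul identity unique, so guessed Christoffel symbols
can be verified without inverting the metric. -/
theorem christoffel_eq_of_koszul (hG : ∀ v, (∀ w, G y v w = 0) → v = 0) {u v c : E}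
    (hc : ∀ w, G y c w
      = (1 / 2) * (fderiv ℝ G y u v w + fderiv ℝ G y v u w - fderiv ℝ G y w u v)) :
    christoffel G y u v = c := by
  rw [← sub_eq_zero]
  refine hG _ fun w => ?_
  rw [map_sub, sub_apply, christoffel_koszul hG, hc, sub_self]

theorem IsMetricAt.christoffel_symm (h : IsMetricAt G y) (u v : E) :
    christoffel G y u v = christoffel G y v u := by
  refine christoffel_eq_of_koszul h.nondegenerate.self_of_nhds fun w => ?_
  rw [christoffel_koszul h.nondegenerate.self_of_nhds, h.fderiv_symm w u v]
  ring

/-- The Levi-Civita connection is metric. -/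
theorem IsMetricAt.fderiv_eq (h : IsMetricAt G y) (u v w : E) :
    fderiv ℝ G y u v w = G y (christoffel G y u v) w + G y v (christoffel G y u w) := by
  rw [h.symm.self_of_nhds v, christoffel_koszul h.nondegenerate.self_of_nhds,
    christoffel_koszul h.nondegenerate.self_of_nhds, h.fderiv_symm u w v]
  ring

set_option maxSynthPendingDepth 4 in
theorem IsMetricAt.differentiableAt_christoffel (h : IsMetricAt G y) (u v : E) :
    DifferentiableAt ℝ (fun z => christoffel G z u v) y := by
  have hs := h.smooth.self_of_nhds
  obtain ⟨e, he⟩ := exists_equiv_of_nondegenerate (G y) h.nondegenerate.self_of_nhds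
  have hinv : DifferentiableAt ℝ (fun z => (G z).inverse) y := by
    have h1 : ContDiffAt ℝ ∞ ContinuousLinearMap.inverse (G y) := by
      rw [← he]; exact contDiffAt_map_inverse e
    exact (h1.comp y hs).differentiableAt (by simp)
  have hd : DifferentiableAt ℝ (fderiv ℝ G) y :=
    (hs.fderiv_right (m := 1) (by norm_cast)).differentiableAt (by simp)
  have hflip : DifferentiableAt ℝ (fun z => ((fderiv ℝ G z).flip u).flip v) y :=
    (differentiableAt_const (ContinuousLinearMap.apply ℝ ℝ v)).clm_comp
      ((differentiableAt_const (ContinuousLinearMap.apply ℝ (E →L[ℝ] ℝ) u)).clm_comp hd)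
  exact hinv.clm_apply
    (((((hd.clm_apply (differentiableAt_const u)).clm_apply (differentiableAt_const v)).add
      ((hd.clm_apply (differentiableAt_const v)).clm_apply (differentiableAt_const u))).sub
        hflip).const_smul (1 / 2 : ℝ))

end Christoffel

theorem quarterCoeff_zero_left {E : Type*} [NormedAddCommGroup E] [NormedSpace ℝ E]
    {G : E → E →L[ℝ] E →L[ℝ] ℝ} {P : E → E} {y : E} {lam₁ lam₂ : ℝ} (v : E) :
    quarterCoeff lam₁ lam₂ G P y 0 v = 0 := by
  simp [quarterCoeff, christoffel_zero_left]

/-! ### Curvature and Ricci tensor of the modified connection -/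

section Quarter

variable {E : Type*} [NormedAddCommGroup E] [NormedSpace ℝ E] [FiniteDimensional ℝ E]
  {G : E → E →L[ℝ] E →L[ℝ] ℝ} {P : E → E} {y : E} {lam₁ lam₂ : ℝ}

theorem fderiv_quarterCoeff (hG : IsMetricAt G y) (hP : DifferentiableAt ℝ P y) (u e v : E) :
    fderiv ℝ (fun z => quarterCoeff lam₁ lam₂ G P z e v) y u
      = fderiv ℝ (fun z => christoffel G z e v) y u
        + (lam₁ * (fderiv ℝ G y u v (P y) + G y v (fderiv ℝ P y u))) • e
        - ((lam₂ * fderiv ℝ G y u e v) • P y + (lam₂ * G y e v) • fderiv ℝ P y u) := by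
  have hd := hG.differentiableAt.hasFDerivAt
  have h1 := (hd.clm_apply (hasFDerivAt_const v y)).clm_apply hP.hasFDerivAt
  have h2 := (hd.clm_apply (hasFDerivAt_const e y)).clm_apply (hasFDerivAt_const v y)
  have h3 := (((hG.differentiableAt_christoffel e v).hasFDerivAt.add
    ((h1.const_mul lam₁).smul_const e)).sub ((h2.const_mul lam₂).smul hP.hasFDerivAt))
  have h4 : HasFDerivAt (fun z => quarterCoeff lam₁ lam₂ G P z e v) _ y := h3
  rw [h4.fderiv]
  simp
  module

/-- The difference tensor is A(X, Y) = λ₁π(Y)X - λ₂g(X, Y)P, and the curvature changes by the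
antisymmetrized ∇A plus the commutator of A. Rewriting derivatives of `G` by metric compatibility
and those of `P` by ∇P cancels every Christoffel symbol outside the Levi-Civita curvature. -/
theorem curvature_quarterCoeff (hG : IsMetricAt G y) (hP : DifferentiableAt ℝ P y) (u e v : E) :
    curvature (quarterCoeff lam₁ lam₂ G P) (fun _ => u) (fun _ => e) (fun _ => v) y
      = curvature (christoffel G) (fun _ => u) (fun _ => e) (fun _ => v) y
        + (lam₁ * G y v (covDeriv (christoffel G) (fun _ => u) P y)
            - lam₁ ^ 2 * G y v (P y) * G y u (P y)
            + lam₁ * lam₂ * G y (P y) (P y) * G y u v) • e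
        - (lam₁ * G y v (covDeriv (christoffel G) (fun _ => e) P y)
            - lam₁ ^ 2 * G y v (P y) * G y e (P y)
            + lam₁ * lam₂ * G y (P y) (P y) * G y e v) • u
        - (lam₂ * G y e v) • covDeriv (christoffel G) (fun _ => u) P y
        + (lam₂ * G y u v) • covDeriv (christoffel G) (fun _ => e) P y
        + (lam₂ ^ 2 * (G y e v * G y u (P y) - G y u v * G y e (P y))) • P y := by
  have hs := hG.symm.self_of_nhds
  rw [curvature_const quarterCoeff_zero_left, curvature_const christoffel_zero_left,
    fderiv_quarterCoeff hG hP, fderiv_quarterCoeff hG hP, hG.fderiv_eq u v, hG.fderiv_eq e v,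
    hG.fderiv_eq u e, hG.fderiv_eq e u]
  have hN (a : E) : fderiv ℝ P y a
      = covDeriv (christoffel G) (fun _ => a) P y - christoffel G y a (P y) := by
    simp [covDeriv]
  rw [hN u, hN e]
  generalize covDeriv (christoffel G) (fun _ => u) P y = Nu
  generalize covDeriv (christoffel G) (fun _ => e) P y = Ne
  have hneg (a b c : E) : christoffel G y a (b - c) = christoffel G y a b - christoffel G y a c := by
    rw [sub_eq_add_neg, ← neg_one_smul ℝ c, christoffel_add_right, christoffel_smul_right]
    module
  simp only [quarterCoeff, christoffel_add_right, christoffel_smul_right, hneg, map_add, map_sub,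
    map_smul, add_apply, sub_apply, smul_apply, smul_eq_mul,
    hG.christoffel_symm e u, hs e u]
  module

/-- The Ricci tensor of `∇̄` in terms of that of the Levi-Civita connection `∇`. -/
theorem ricciLocal_quarterCoeff (hG : IsMetricAt G y) (hP : DifferentiableAt ℝ P y) (u v : E) :
    ricciLocal (quarterCoeff lam₁ lam₂ G P) y u v
      = ricciLocal (christoffel G) y u v
        + (((Module.finrank ℝ E : ℝ) - 1) * lam₁ - lam₂)
            * G y v (covDeriv (christoffel G) (fun _ => u) P y)
        + lam₂ * traceOf (fun e => covDeriv (christoffel G) (fun _ => e) P y) * G y u v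
        + (lam₂ ^ 2 - ((Module.finrank ℝ E : ℝ) - 1) * lam₁ ^ 2) * G y u (P y) * G y v (P y)
        + (((Module.finrank ℝ E : ℝ) - 1) * lam₁ * lam₂ - lam₂ ^ 2)
            * G y (P y) (P y) * G y u v := by
  have hs := hG.symm.self_of_nhds
  let N : E →ₗ[ℝ] E := (fderiv ℝ P y : E →ₗ[ℝ] E) +
    { toFun := fun e => christoffel G y e (P y)
      map_add' := fun a b => christoffel_add_left a b _
      map_smul' := fun a b => christoffel_smul_left a b _ }
  have hN (e : E) : covDeriv (christoffel G) (fun _ => e) P y = N e := rfl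
  -- The coefficients of u, ∇_u P and P as linear functionals of the traced vector e. Their rank-one
  -- terms are traced by evaluation; only the terms in e and ∇_e P yield the dimension and the
  -- divergence.
  let φ₁ : E →ₗ[ℝ] ℝ := lam₁ • ((G y v : E →ₗ[ℝ] ℝ) ∘ₗ N)
    - (lam₁ ^ 2 * G y v (P y)) • (G y (P y) : E →ₗ[ℝ] ℝ)
    + (lam₁ * lam₂ * G y (P y) (P y)) • (G y v : E →ₗ[ℝ] ℝ)
  let φ₂ : E →ₗ[ℝ] ℝ := lam₂ • (G y v : E →ₗ[ℝ] ℝ)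
  let φ₃ : E →ₗ[ℝ] ℝ := lam₂ ^ 2 • (G y u (P y) • (G y v : E →ₗ[ℝ] ℝ)
    - G y u v • (G y (P y) : E →ₗ[ℝ] ℝ))
  have key (e : E) : curvature (quarterCoeff lam₁ lam₂ G P) (fun _ => u) (fun _ => e) (fun _ => v) y
      = curvature (christoffel G) (fun _ => u) (fun _ => e) (fun _ => v) y
        + (lam₁ * G y v (N u) - lam₁ ^ 2 * G y v (P y) * G y u (P y)
            + lam₁ * lam₂ * G y (P y) (P y) * G y u v) • e
        - φ₁ e • u - φ₂ e • N u + (lam₂ * G y u v) • N e + φ₃ e • P y := by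
    rw [curvature_quarterCoeff hG hP, hN, hN]
    simp [φ₁, φ₂, φ₃, hs e]
    module
  simp only [ricciLocal, key, hN]
  rw [traceOf_add, traceOf_add, traceOf_sub, traceOf_sub, traceOf_add, traceOf_smul_id,
    traceOf_smul, traceOf_rankOne, traceOf_rankOne, traceOf_rankOne]
  simp [φ₁, φ₂, φ₃, hs v u, hs (P y) u]
  ring

end Quarter

set_option maxSynthPendingDepth 4 in
-- Pulling back along a fixed `L` is linear in the form, hence continuous because forms on `A` make
-- up a finite-dimensional space.
theorem contDiffAt_bilinearComp {A B X : Type*} [NormedAddCommGroup A] [NormedSpace ℝ A]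
    [FiniteDimensional ℝ A] [NormedAddCommGroup B] [NormedSpace ℝ B] [NormedAddCommGroup X]
    [NormedSpace ℝ X] {g : X → A →L[ℝ] A →L[ℝ] ℝ} {x : X} {n : WithTop ℕ∞}
    (hg : ContDiffAt ℝ n g x) (L : B →L[ℝ] A) :
    ContDiffAt ℝ n (fun z => (g z).bilinearComp L L) x := by
  let Λ : (A →L[ℝ] A →L[ℝ] ℝ) →ₗ[ℝ] B →L[ℝ] B →L[ℝ] ℝ :=
    { toFun := fun f => f.bilinearComp L L
      map_add' := fun f g => by ext; simp
      map_smul' := fun c f => by ext; simp }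
  let Λ' := Λ.toContinuousLinearMap
  have h := Λ'.contDiff.contDiffAt.comp x hg
  exact h

theorem tendsto_snd_apply {ι : Type*} {V : ι → Type*} [∀ i, TopologicalSpace (V i)]
    (y : ℝ × ∀ i, V i) (i : ι) :
    Tendsto (fun z : ℝ × ∀ i, V i => z.2 i) (𝓝 y) (𝓝 (y.2 i)) :=
  Continuous.tendsto (by fun_prop) y

/-! ### The warped product metric and its Christoffel symbols -/

section LocalWarped

variable {ι : Type*} [Fintype ι] {V : ι → Type*}
  [∀ i, NormedAddCommGroup (V i)] [∀ i, NormedSpace ℝ (V i)]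

/-- The bilinear form `-dt² ⊕ β₁² g₁ ⊕ ⋯ ⊕ β_m² g_m`. -/
def warpedForm (β : ι → ℝ) (g : ∀ i, V i →L[ℝ] V i →L[ℝ] ℝ) :
    (ℝ × ∀ i, V i) →L[ℝ] (ℝ × ∀ i, V i) →L[ℝ] ℝ :=
  -(ContinuousLinearMap.mul ℝ ℝ).bilinearComp (ContinuousLinearMap.fst ℝ ℝ _)
      (ContinuousLinearMap.fst ℝ ℝ _)
    + ∑ i, (β i) ^ 2 • (g i).bilinearComp
        ((ContinuousLinearMap.proj i).comp (ContinuousLinearMap.snd ℝ ℝ _))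
        ((ContinuousLinearMap.proj i).comp (ContinuousLinearMap.snd ℝ ℝ _))

theorem warpedForm_apply (β : ι → ℝ) (g : ∀ i, V i →L[ℝ] V i →L[ℝ] ℝ) (p q : ℝ × ∀ i, V i) :
    warpedForm β g p q = -(p.1 * q.1) + ∑ i, β i ^ 2 * g i (p.2 i) (q.2 i) := by
  simp [warpedForm]

/-- The warped product metric in coordinates. -/
def localWarped (b : ι → ℝ → ℝ) (G : ∀ i, V i → V i →L[ℝ] V i →L[ℝ] ℝ) (y : ℝ × ∀ i, V i) :
    (ℝ × ∀ i, V i) →L[ℝ] (ℝ × ∀ i, V i) →L[ℝ] ℝ :=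
  warpedForm (fun i => b i y.1) (fun i => G i (y.2 i))

/-- The Christoffel symbols of the warped product metric. -/
def warpedCoeff (b : ι → ℝ → ℝ) (G : ∀ i, V i → V i →L[ℝ] V i →L[ℝ] ℝ)
    (y u v : ℝ × ∀ i, V i) : ℝ × ∀ i, V i :=
  (∑ i, b i y.1 * deriv (b i) y.1 * G i (y.2 i) (u.2 i) (v.2 i),
    fun i => christoffel (G i) (y.2 i) (u.2 i) (v.2 i)
      + (deriv (b i) y.1 / b i y.1) • (u.1 • v.2 i + v.1 • u.2 i))

/-- Near `y`, the warping functions are smooth and positive and the `G i` are metrics. -/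
structure IsWarpedAt (b : ι → ℝ → ℝ) (G : ∀ i, V i → V i →L[ℝ] V i →L[ℝ] ℝ)
    (y : ℝ × ∀ i, V i) : Prop where
  smooth : ∀ i, ∀ᶠ t in 𝓝 y.1, ContDiffAt ℝ ∞ (b i) t
  pos : ∀ i, ∀ᶠ t in 𝓝 y.1, 0 < b i t
  metric : ∀ i, IsMetricAt (G i) (y.2 i)

variable {b : ι → ℝ → ℝ} {G : ∀ i, V i → V i →L[ℝ] V i →L[ℝ] ℝ} {y : ℝ × ∀ i, V i}

theorem IsWarpedAt.eventually (h : IsWarpedAt b G y) : ∀ᶠ z in 𝓝 y, IsWarpedAt b G z := by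
  have h₁ : ∀ᶠ z in 𝓝 y, ∀ i, ∀ᶠ t in 𝓝 z.1, ContDiffAt ℝ ∞ (b i) t :=
    eventually_all.2 fun i => continuous_fst.continuousAt.eventually (h.smooth i).eventually_nhds
  have h₂ : ∀ᶠ z in 𝓝 y, ∀ i, ∀ᶠ t in 𝓝 z.1, 0 < b i t :=
    eventually_all.2 fun i => continuous_fst.continuousAt.eventually (h.pos i).eventually_nhds
  have h₃ : ∀ᶠ z in 𝓝 y, ∀ i, IsMetricAt (G i) (z.2 i) :=
    eventually_all.2 fun i => (tendsto_snd_apply y i).eventually (h.metric i).eventually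
  filter_upwards [h₁, h₂, h₃] with z h₁ h₂ h₃ using ⟨h₁, h₂, h₃⟩

theorem IsWarpedAt.hasFDerivAt_metric (h : IsWarpedAt b G y) (i : ι) (v w : V i) :
    HasFDerivAt (fun z : ℝ × ∀ i, V i => G i (z.2 i) v w)
      ((((fderiv ℝ (G i) (y.2 i)).flip v).flip w).comp
        ((ContinuousLinearMap.proj i).comp (ContinuousLinearMap.snd ℝ ℝ _))) y := by
  have h1 := ((h.metric i).differentiableAt.hasFDerivAt.clm_apply
    (hasFDerivAt_const v _)).clm_apply (hasFDerivAt_const w _)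
  have h2 := h1.comp y ((ContinuousLinearMap.proj (R := ℝ) (φ := V) i).comp
    (ContinuousLinearMap.snd ℝ ℝ _)).hasFDerivAt
  refine h2.congr_fderiv ?_
  ext <;> simp

theorem hasFDerivAt_comp_fst {f : ℝ → ℝ} {f' : ℝ} (hf : HasDerivAt f f' y.1) :
    HasFDerivAt (fun z : ℝ × ∀ i, V i => f z.1) (f' • ContinuousLinearMap.fst ℝ ℝ (∀ i, V i)) y :=
  hf.comp_hasFDerivAt y (hasFDerivAt_fst (p := y))

variable [∀ i, FiniteDimensional ℝ (V i)]

set_option maxSynthPendingDepth 4 in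
theorem IsWarpedAt.isMetricAt [DecidableEq ι] (h : IsWarpedAt b G y) :
    IsMetricAt (localWarped b G) y where
  symm := by
    filter_upwards [h.eventually] with z hz v w
    simp only [localWarped, warpedForm_apply]
    congr 1
    · ring
    · exact Finset.sum_congr rfl fun i _ => by rw [(hz.metric i).symm.self_of_nhds]
  nondegenerate := by
    filter_upwards [h.eventually] with z hz v hv
    simp only [localWarped, warpedForm_apply] at hv
    refine Prod.ext ?_ (funext fun i => ?_)
    · simpa using hv (1, 0)
    · refine (hz.metric i).nondegenerate.self_of_nhds _ fun w => ?_
      have h1 := hv (0, Pi.single i w)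
      rw [Finset.sum_eq_single i (fun j _ hj => by simp [hj]) (by simp)] at h1
      simpa [(hz.pos i).self_of_nhds.ne'] using h1
  smooth := by
    filter_upwards [h.eventually] with z hz
    unfold localWarped warpedForm
    refine contDiffAt_const.add (ContDiffAt.sum fun i _ => ?_)
    let L : (ℝ × ∀ i, V i) →L[ℝ] V i :=
      (ContinuousLinearMap.proj i).comp (ContinuousLinearMap.snd ℝ ℝ _)
    have h1 : ContDiffAt ℝ ∞ (fun z : ℝ × ∀ i, V i => G i (z.2 i)) z :=
      (hz.metric i).smooth.self_of_nhds.comp z L.contDiff.contDiffAt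
    have h2 : ContDiffAt ℝ ∞ (fun z : ℝ × ∀ i, V i => (G i (z.2 i)).bilinearComp L L) z :=
      contDiffAt_bilinearComp h1 L
    have h3 : ContDiffAt ℝ ∞ (fun z : ℝ × ∀ i, V i => b i z.1 ^ 2) z :=
      ((hz.smooth i).self_of_nhds.comp z contDiffAt_fst).pow 2
    exact h3.smul h2

theorem IsWarpedAt.fderiv_localWarped [DecidableEq ι] (h : IsWarpedAt b G y) (u v w : ℝ × ∀ i, V i) :
    fderiv ℝ (localWarped b G) y u v w
      = ∑ i, (2 * b i y.1 * deriv (b i) y.1 * u.1 * G i (y.2 i) (v.2 i) (w.2 i)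
        + b i y.1 ^ 2 * fderiv ℝ (G i) (y.2 i) (u.2 i) (v.2 i) (w.2 i)) := by
  rw [← fderiv_apply_apply h.isMetricAt.differentiableAt]
  simp only [localWarped, warpedForm_apply]
  have hb (i) : HasDerivAt (b i) (deriv (b i) y.1) y.1 :=
    ((h.smooth i).self_of_nhds.differentiableAt (by simp)).hasDerivAt
  have h1 := (hasFDerivAt_const (-(v.1 * w.1)) y).add (HasFDerivAt.fun_sum fun i (_ : i ∈ Finset.univ) =>
    ((hasFDerivAt_comp_fst (V := V) (hb i)).pow 2).mul (h.hasFDerivAt_metric i (v.2 i) (w.2 i)))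
  have h2 : HasFDerivAt (fun z : ℝ × ∀ i, V i =>
    -(v.1 * w.1) + ∑ i, b i z.1 ^ 2 * G i (z.2 i) (v.2 i) (w.2 i)) _ y := h1
  rw [h2.fderiv]
  simp
  exact Finset.sum_congr rfl fun i _ => by ring

/-- The Koszul identity is checked fiber by fiber. The time component of `warpedCoeff` carries a
plus sign because the time direction has g = -1. -/
theorem IsWarpedAt.christoffel_eq [DecidableEq ι] (h : IsWarpedAt b G y) :
    christoffel (localWarped b G) y = warpedCoeff b G y := by
  ext1 u
  ext1 v
  refine christoffel_eq_of_koszul h.isMetricAt.nondegenerate.self_of_nhds fun w => ?_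
  rw [h.fderiv_localWarped, h.fderiv_localWarped, h.fderiv_localWarped, localWarped,
    warpedForm_apply, ← Finset.sum_add_distrib, ← Finset.sum_sub_distrib, Finset.mul_sum]
  simp only [warpedCoeff, Finset.sum_mul, ← Finset.sum_neg_distrib, ← Finset.sum_add_distrib]
  refine Finset.sum_congr rfl fun i _ => ?_
  have hb := (h.pos i).self_of_nhds.ne'
  simp only [map_add, map_smul, add_apply, smul_apply, smul_eq_mul,
    christoffel_koszul (h.metric i).nondegenerate.self_of_nhds]
  rw [(h.metric i).symm.self_of_nhds (u.2 i) (v.2 i)]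
  field_simp
  ring

theorem IsWarpedAt.fderiv_warpedCoeff [DecidableEq ι] (h : IsWarpedAt b G y)
    (u e v : ℝ × ∀ i, V i) :
    fderiv ℝ (fun z => warpedCoeff b G z e v) y u
      = (∑ i, ((deriv (b i) y.1 ^ 2 + b i y.1 * deriv (deriv (b i)) y.1) * u.1
            * G i (y.2 i) (e.2 i) (v.2 i)
          + b i y.1 * deriv (b i) y.1 * fderiv ℝ (G i) (y.2 i) (u.2 i) (e.2 i) (v.2 i)),
        fun i => fderiv ℝ (fun p => christoffel (G i) p (e.2 i) (v.2 i)) (y.2 i) (u.2 i)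
          + ((deriv (deriv (b i)) y.1 / b i y.1 - (deriv (b i) y.1 / b i y.1) ^ 2) * u.1)
            • (e.1 • v.2 i + v.1 • e.2 i)) := by
  have hb (i) : HasDerivAt (b i) (deriv (b i) y.1) y.1 :=
    ((h.smooth i).self_of_nhds.differentiableAt (by simp)).hasDerivAt
  have hb' (i) : HasDerivAt (deriv (b i)) (deriv (deriv (b i)) y.1) y.1 :=
    (((h.smooth i).self_of_nhds.fderiv_right (m := 1) (by norm_cast)).differentiableAt
      (by simp)).clm_apply (differentiableAt_const (1 : ℝ)) |>.hasDerivAt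
  have h1 : HasFDerivAt (fun z => (warpedCoeff b G z e v).1) _ y :=
    HasFDerivAt.fun_sum fun i (_ : i ∈ Finset.univ) =>
    (hasFDerivAt_comp_fst (V := V) ((hb i).mul (hb' i))).mul (h.hasFDerivAt_metric i (e.2 i) (v.2 i))
  have h2 : HasFDerivAt (fun z => (warpedCoeff b G z e v).2) (ContinuousLinearMap.pi _) y :=
    hasFDerivAt_pi.2 fun i =>
    (((h.metric i).differentiableAt_christoffel (e.2 i) (v.2 i)).hasFDerivAt.comp y
      ((ContinuousLinearMap.proj (R := ℝ) (φ := V) i).comp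
        (ContinuousLinearMap.snd ℝ ℝ _)).hasFDerivAt).add
    ((hasFDerivAt_comp_fst (V := V) ((hb' i).div (hb i) (h.pos i).self_of_nhds.ne')).smul_const
      (e.1 • v.2 i + v.1 • e.2 i))
  have h3 : HasFDerivAt (fun z => warpedCoeff b G z e v) _ y := h1.prodMk h2
  rw [h3.fderiv]
  refine Prod.ext ?_ (funext fun i => ?_)
  · simp
    exact Finset.sum_congr rfl fun i _ => by ring
  · have hb := (h.pos i).self_of_nhds.ne'
    have h4 : (deriv (deriv (b i)) y.1 * b i y.1 - deriv (b i) y.1 * deriv (b i) y.1)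
        / b i y.1 ^ 2 = deriv (deriv (b i)) y.1 / b i y.1 - (deriv (b i) y.1 / b i y.1) ^ 2 := by
      field_simp
    simp [h4]

end LocalWarped

/-! ### The Ricci tensor of a multiply warped product -/

section WarpedRicci

theorem IsMetricAt.isLinearMap_curvature {E : Type*} [NormedAddCommGroup E] [NormedSpace ℝ E]
    [FiniteDimensional ℝ E] {G : E → E →L[ℝ] E →L[ℝ] ℝ} {y : E} (h : IsMetricAt G y) (u v : E) :
    IsLinearMap ℝ
      (fun e => curvature (christoffel G) (fun _ => u) (fun _ => e) (fun _ => v) y) where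
  map_add a c := by
    simp only [curvature_const christoffel_zero_left]
    have h1 : fderiv ℝ (fun z => christoffel G z (a + c) v) y
        = fderiv ℝ (fun z => christoffel G z a v) y + fderiv ℝ (fun z => christoffel G z c v) y := by
      simp only [christoffel_add_left]
      exact fderiv_add (h.differentiableAt_christoffel a v) (h.differentiableAt_christoffel c v)
    rw [h1, map_add, add_apply, christoffel_add_left, christoffel_add_left, christoffel_add_right]
    abel
  map_smul k a := by
    simp only [curvature_const christoffel_zero_left]
    have h1 : fderiv ℝ (fun z => christoffel G z (k • a) v) y
        = k • fderiv ℝ (fun z => christoffel G z a v) y := by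
      simp only [christoffel_smul_left]
      exact fderiv_const_smul (h.differentiableAt_christoffel a v) k
    rw [h1, map_smul, smul_apply, christoffel_smul_left, christoffel_smul_left,
      christoffel_smul_right]
    module

theorem ricciLocal_zero_left {E : Type*} [NormedAddCommGroup E] [NormedSpace ℝ E]
    [FiniteDimensional ℝ E] (G : E → E →L[ℝ] E →L[ℝ] ℝ) (y v : E) :
    ricciLocal (christoffel G) y 0 v = 0 := by
  have h (e : E) : curvature (christoffel G) (fun _ => 0) (fun _ => e) (fun _ => v) y = 0 := by
    rw [curvature_const christoffel_zero_left]
    simp [christoffel_zero_left, christoffel_zero_right]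
  simp only [ricciLocal, h]
  simp [traceOf]

variable {ι : Type*} [Fintype ι] [DecidableEq ι] {V : ι → Type*}
  [∀ i, NormedAddCommGroup (V i)] [∀ i, NormedSpace ℝ (V i)] [∀ i, FiniteDimensional ℝ (V i)]
  {b : ι → ℝ → ℝ} {G : ∀ i, V i → V i →L[ℝ] V i →L[ℝ] ℝ} {y : ℝ × ∀ i, V i}

theorem IsWarpedAt.curvature_eq (h : IsWarpedAt b G y) (u e v : ℝ × ∀ i, V i) :
    curvature (christoffel (localWarped b G)) (fun _ => u) (fun _ => e) (fun _ => v) y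
      = (fderiv ℝ (fun z => warpedCoeff b G z e v) y u
          + warpedCoeff b G y u (warpedCoeff b G y e v))
        - (fderiv ℝ (fun z => warpedCoeff b G z u v) y e
          + warpedCoeff b G y e (warpedCoeff b G y u v)) := by
  rw [curvature_congr (h.eventually.mono fun z hz => hz.christoffel_eq) christoffel_zero_left,
    curvature_const]
  exact fun v => by rw [← h.christoffel_eq, christoffel_zero_left]

/-- This and `IsWarpedAt.curvature_fiber` are the diagonal blocks of e ↦ R(u, e)v, all that the
trace needs. -/
theorem IsWarpedAt.curvature_time (h : IsWarpedAt b G y) (u v : ℝ × ∀ i, V i) :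
    (curvature (christoffel (localWarped b G)) (fun _ => u) (fun _ => (1, 0)) (fun _ => v) y).1
      = -∑ i, b i y.1 * deriv (deriv (b i)) y.1 * G i (y.2 i) (u.2 i) (v.2 i) := by
  rw [h.curvature_eq, h.fderiv_warpedCoeff, h.fderiv_warpedCoeff]
  simp only [warpedCoeff, Prod.fst_add, Prod.fst_sub, Pi.zero_apply, map_zero,
    zero_apply, mul_zero, Finset.sum_const_zero, christoffel_zero_left,
    smul_zero, add_zero, zero_add, one_smul, map_smul, smul_eq_mul, mul_one]
  rw [← Finset.sum_sub_distrib, ← Finset.sum_neg_distrib]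
  refine Finset.sum_congr rfl fun i _ => ?_
  have hb := (h.pos i).self_of_nhds.ne'
  field_simp
  ring

theorem IsWarpedAt.curvature_fiber (h : IsWarpedAt b G y) (u v : ℝ × ∀ i, V i) (i : ι) (a : V i) :
    (curvature (christoffel (localWarped b G)) (fun _ => u) (fun _ => (0, Pi.single i a))
        (fun _ => v) y).2 i
      = curvature (christoffel (G i)) (fun _ => u.2 i) (fun _ => a) (fun _ => v.2 i) (y.2 i)
        + (u.1 * v.1 * (deriv (deriv (b i)) y.1 / b i y.1) - deriv (b i) y.1 / b i y.1
            * ∑ j, b j y.1 * deriv (b j) y.1 * G j (y.2 j) (u.2 j) (v.2 j)) • a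
        + (deriv (b i) y.1 ^ 2 * G i (y.2 i) a (v.2 i)) • u.2 i := by
  have hsum : ∑ j, b j y.1 * deriv (b j) y.1 * G j (y.2 j) ((Pi.single i a : ∀ i, V i) j) (v.2 j)
      = b i y.1 * deriv (b i) y.1 * G i (y.2 i) a (v.2 i) := by
    rw [Finset.sum_eq_single i (fun j _ hj => by simp [hj]) (by simp)]
    simp
  rw [h.curvature_eq, h.fderiv_warpedCoeff, h.fderiv_warpedCoeff,
    curvature_const christoffel_zero_left]
  simp only [warpedCoeff, Prod.snd_add, Prod.snd_sub, Pi.add_apply, Pi.sub_apply, hsum,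
    Pi.single_eq_same, zero_smul, zero_add, mul_zero, add_zero, christoffel_add_right,
    christoffel_smul_right, (h.metric i).christoffel_symm a (u.2 i)]
  have hb := (h.pos i).self_of_nhds.ne'
  have hb2 : deriv (b i) y.1 ^ 2
      = deriv (b i) y.1 / b i y.1 * (b i y.1 * deriv (b i) y.1) := by field_simp
  rw [hb2]
  module

/-- The Ricci tensor of a multiply warped product. -/
theorem IsWarpedAt.ricciLocal_eq (h : IsWarpedAt b G y) (u v : ℝ × ∀ i, V i) :
    ricciLocal (christoffel (localWarped b G)) y u v
      = ∑ i, ricciLocal (christoffel (G i)) (y.2 i) (u.2 i) (v.2 i)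
        + u.1 * v.1 * ∑ i, (Module.finrank ℝ (V i) : ℝ) * (deriv (deriv (b i)) y.1 / b i y.1)
        + ∑ i, (-(b i y.1 * deriv (deriv (b i)) y.1)
            - b i y.1 * deriv (b i) y.1 * ∑ s ∈ Finset.univ.erase i,
              (Module.finrank ℝ (V s) : ℝ) * (deriv (b s) y.1 / b s y.1)
            - ((Module.finrank ℝ (V i) : ℝ) - 1) * deriv (b i) y.1 ^ 2)
          * G i (y.2 i) (u.2 i) (v.2 i) := by
  have htr (i : ι) : traceOf (fun a => (curvature (christoffel (localWarped b G)) (fun _ => u)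
      (fun _ => (0, Pi.single i a)) (fun _ => v) y).2 i)
      = ricciLocal (christoffel (G i)) (y.2 i) (u.2 i) (v.2 i)
        + (u.1 * v.1 * (deriv (deriv (b i)) y.1 / b i y.1) - deriv (b i) y.1 / b i y.1
            * ∑ j, b j y.1 * deriv (b j) y.1 * G j (y.2 j) (u.2 j) (v.2 j))
          * Module.finrank ℝ (V i)
        + deriv (b i) y.1 ^ 2 * G i (y.2 i) (u.2 i) (v.2 i) := by
    simp only [h.curvature_fiber, traceOf_add, traceOf_smul_id, ricciLocal]
    congr 1
    have h1 := traceOf_rankOne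
      (deriv (b i) y.1 ^ 2 • ((G i (y.2 i)).flip (v.2 i) : V i →ₗ[ℝ] ℝ)) (u.2 i)
    simpa using h1
  rw [ricciLocal, traceOf_prod_pi (h.isMetricAt.isLinearMap_curvature u v), h.curvature_time]
  simp only [htr]
  set S := ∑ j, b j y.1 * deriv (b j) y.1 * G j (y.2 j) (u.2 j) (v.2 j) with hS
  set Θ := ∑ s, (Module.finrank ℝ (V s) : ℝ) * (deriv (b s) y.1 / b s y.1) with hΘ
  have herase (i : ι) : ∑ s ∈ Finset.univ.erase i,
      (Module.finrank ℝ (V s) : ℝ) * (deriv (b s) y.1 / b s y.1)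
      = Θ - (Module.finrank ℝ (V i) : ℝ) * (deriv (b i) y.1 / b i y.1) := by
    rw [hΘ, ← Finset.add_sum_erase _ _ (Finset.mem_univ i)]
    ring
  -- Both sides equal Θ S. The product is redistributed over the fibers of S, giving each metric `G
  -- i` the coefficient Θ b_i b_i'; `herase` then removes the index i from Θ.
  have hΘS : ∑ i, (deriv (b i) y.1 / b i y.1 * S) * (Module.finrank ℝ (V i) : ℝ)
      = ∑ i, Θ * (b i y.1 * deriv (b i) y.1 * G i (y.2 i) (u.2 i) (v.2 i)) := by
    rw [← Finset.mul_sum, ← hS, hΘ, Finset.sum_mul]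
    exact Finset.sum_congr rfl fun i _ => by ring
  simp only [herase, sub_mul, Finset.sum_add_distrib, Finset.sum_sub_distrib, hΘS, Finset.mul_sum]
  rw [← sub_eq_zero]
  simp only [← Finset.sum_add_distrib, ← Finset.sum_sub_distrib, ← Finset.sum_neg_distrib]
  refine Finset.sum_eq_zero fun i _ => ?_
  have hb := (h.pos i).self_of_nhds.ne'
  field_simp
  ring

end WarpedRicci

/-! ### Vector fields lifted from one fiber -/

section LiftedField

variable {ι : Type*} [Fintype ι] [DecidableEq ι] {V : ι → Type*}
  [∀ i, NormedAddCommGroup (V i)] [∀ i, NormedSpace ℝ (V i)]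
  {b : ι → ℝ → ℝ} {G : ∀ i, V i → V i →L[ℝ] V i →L[ℝ] ℝ} {y : ℝ × ∀ i, V i} {r : ι} {Q : V r → V r}

/-- The lift of a vector field on the factor `r`. -/
def localLift (r : ι) (Q : V r → V r) (y : ℝ × ∀ i, V i) : ℝ × ∀ i, V i :=
  (0, Pi.single r (Q (y.2 r)))

theorem hasFDerivAt_localLift (hQ : DifferentiableAt ℝ Q (y.2 r)) :
    HasFDerivAt (localLift r Q)
      ((ContinuousLinearMap.inr ℝ ℝ (∀ i, V i)).comp
        ((ContinuousLinearMap.single ℝ V r).comp ((fderiv ℝ Q (y.2 r)).comp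
          ((ContinuousLinearMap.proj r).comp (ContinuousLinearMap.snd ℝ ℝ _))))) y := by
  have h1 := hQ.hasFDerivAt.comp y ((ContinuousLinearMap.proj (R := ℝ) (φ := V) r).comp
    (ContinuousLinearMap.snd ℝ ℝ _)).hasFDerivAt
  exact ((ContinuousLinearMap.inr ℝ ℝ (∀ i, V i)).comp
    (ContinuousLinearMap.single ℝ V r)).hasFDerivAt.comp y h1

theorem localWarped_localLift (u : ℝ × ∀ i, V i) :
    localWarped b G y u (localLift r Q y) = b r y.1 ^ 2 * G r (y.2 r) (u.2 r) (Q (y.2 r)) := by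
  rw [localWarped, warpedForm_apply, localLift,
    Finset.sum_eq_single r (fun j _ hj => by simp [hj]) (by simp)]
  simp

variable [∀ i, FiniteDimensional ℝ (V i)]

theorem IsWarpedAt.covDeriv_localLift (h : IsWarpedAt b G y) (hQ : DifferentiableAt ℝ Q (y.2 r))
    (u : ℝ × ∀ i, V i) :
    covDeriv (christoffel (localWarped b G)) (fun _ => u) (localLift r Q) y
      = (b r y.1 * deriv (b r) y.1 * G r (y.2 r) (u.2 r) (Q (y.2 r)),
        Pi.single r (covDeriv (christoffel (G r)) (fun _ => u.2 r) Q (y.2 r)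
          + (deriv (b r) y.1 / b r y.1 * u.1) • Q (y.2 r))) := by
  rw [covDeriv, (hasFDerivAt_localLift hQ).fderiv, h.christoffel_eq]
  refine Prod.ext ?_ (funext fun i => ?_)
  · simp only [warpedCoeff, localLift, Prod.fst_add]
    rw [Finset.sum_eq_single r (fun j _ hj => by simp [hj]) (by simp)]
    simp
  · by_cases hi : i = r
    · subst hi
      simp [warpedCoeff, localLift, covDeriv]
      module
    · simp [warpedCoeff, localLift, hi, christoffel_zero_right]

/-- The warping terms of ∇P are off-diagonal: the time component vanishes on ∂_t, and the correction
along F_r vanishes on vectors tangent to the fibers. -/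
theorem IsWarpedAt.divergence_localLift (h : IsWarpedAt b G y)
    (hQ : DifferentiableAt ℝ Q (y.2 r)) :
    traceOf (fun e => covDeriv (christoffel (localWarped b G)) (fun _ => e) (localLift r Q) y)
      = traceOf (fun e => covDeriv (christoffel (G r)) (fun _ => e) Q (y.2 r)) := by
  rw [traceOf_prod_pi]
  · simp only [h.covDeriv_localLift hQ]
    rw [Finset.sum_eq_single r]
    · simp [covDeriv]
    · intro i _ hi
      simp [hi, traceOf]
    · simp
  · constructor
    · intro u v
      simp only [covDeriv, map_add, christoffel_add_left]
      abel
    · intro c u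
      simp only [covDeriv, map_smul, christoffel_smul_left, smul_add]

/-- The two b_r b_r' terms are antisymmetric in u and v. They are the only source of mixed
time-fiber terms in the Einstein equation. -/
theorem IsWarpedAt.localWarped_covDeriv (h : IsWarpedAt b G y) (hQ : DifferentiableAt ℝ Q (y.2 r))
    (u v : ℝ × ∀ i, V i) :
    localWarped b G y v
        (covDeriv (christoffel (localWarped b G)) (fun _ => u) (localLift r Q) y)
      = -(v.1 * (b r y.1 * deriv (b r) y.1 * G r (y.2 r) (u.2 r) (Q (y.2 r))))
        + b r y.1 ^ 2 * G r (y.2 r) (v.2 r)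
          (covDeriv (christoffel (G r)) (fun _ => u.2 r) Q (y.2 r))
        + b r y.1 * deriv (b r) y.1 * u.1 * G r (y.2 r) (v.2 r) (Q (y.2 r)) := by
  rw [h.covDeriv_localLift hQ, localWarped, warpedForm_apply,
    Finset.sum_eq_single r (fun j _ hj => by simp [hj]) (by simp)]
  have hb := (h.pos r).self_of_nhds.ne'
  simp
  field_simp
  ring

theorem IsWarpedAt.ricciLocal_quarterCoeff_eq (h : IsWarpedAt b G y)
    (hQ : DifferentiableAt ℝ Q (y.2 r)) (lam₁ lam₂ : ℝ) {n : ℝ}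
    (hn : (Module.finrank ℝ (ℝ × ∀ i, V i) : ℝ) = n) (u v : ℝ × ∀ i, V i) :
    ricciLocal (quarterCoeff lam₁ lam₂ (localWarped b G) (localLift r Q)) y u v
      = ∑ i, ricciLocal (christoffel (G i)) (y.2 i) (u.2 i) (v.2 i)
        + u.1 * v.1 * ∑ i, (Module.finrank ℝ (V i) : ℝ) * (deriv (deriv (b i)) y.1 / b i y.1)
        + ∑ i, (-(b i y.1 * deriv (deriv (b i)) y.1)
            - b i y.1 * deriv (b i) y.1 * ∑ s ∈ Finset.univ.erase i,
              (Module.finrank ℝ (V s) : ℝ) * (deriv (b s) y.1 / b s y.1)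
            - ((Module.finrank ℝ (V i) : ℝ) - 1) * deriv (b i) y.1 ^ 2)
          * G i (y.2 i) (u.2 i) (v.2 i)
        + ((n - 1) * lam₁ - lam₂) * localWarped b G y v
            (covDeriv (christoffel (localWarped b G)) (fun _ => u) (localLift r Q) y)
        + lam₂ * traceOf (fun e => covDeriv (christoffel (G r)) (fun _ => e) Q (y.2 r))
          * localWarped b G y u v
        + (lam₂ ^ 2 - (n - 1) * lam₁ ^ 2)
          * (b r y.1 ^ 2 * G r (y.2 r) (u.2 r) (Q (y.2 r)))
          * (b r y.1 ^ 2 * G r (y.2 r) (v.2 r) (Q (y.2 r)))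
        + ((n - 1) * lam₁ * lam₂ - lam₂ ^ 2)
          * (b r y.1 ^ 2 * G r (y.2 r) (Q (y.2 r)) (Q (y.2 r))) * localWarped b G y u v := by
  rw [ricciLocal_quarterCoeff h.isMetricAt (hasFDerivAt_localLift hQ).differentiableAt, hn,
    h.divergence_localLift hQ, localWarped_localLift, localWarped_localLift,
    localWarped_localLift, h.ricciLocal_eq]
  simp [localLift]

end LiftedField

/-! ### Dependence on germs only -/

section Congruence

variable {E : Type*} [NormedAddCommGroup E] [NormedSpace ℝ E]
  {G G' : E → E →L[ℝ] E →L[ℝ] ℝ} {P P' : E → E} {y : E}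

theorem christoffel_congr (h : G =ᶠ[𝓝 y] G') : christoffel G y = christoffel G' y := by
  unfold christoffel
  rw [h.fderiv_eq, h.eq_of_nhds]

theorem quarterCoeff_congr (lam₁ lam₂ : ℝ) (h : G =ᶠ[𝓝 y] G') (hP : P =ᶠ[𝓝 y] P') :
    ∀ᶠ z in 𝓝 y, quarterCoeff lam₁ lam₂ G P z = quarterCoeff lam₁ lam₂ G' P' z := by
  filter_upwards [h.eventuallyEq_nhds, hP] with z h₁ h₂
  unfold quarterCoeff
  rw [christoffel_congr h₁, h₁.eq_of_nhds, h₂]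

theorem covDeriv_christoffel_congr (h : G =ᶠ[𝓝 y] G') (hP : P =ᶠ[𝓝 y] P') (X : E → E) :
    covDeriv (christoffel G) X P y = covDeriv (christoffel G') X P' y := by
  rw [covDeriv, covDeriv, christoffel_congr h, hP.fderiv_eq, hP.eq_of_nhds]

theorem ricciLocal_quarterCoeff_congr [FiniteDimensional ℝ E] (lam₁ lam₂ : ℝ) (h : G =ᶠ[𝓝 y] G')
    (hP : P =ᶠ[𝓝 y] P') (u v : E) :
    ricciLocal (quarterCoeff lam₁ lam₂ G P) y u v
      = ricciLocal (quarterCoeff lam₁ lam₂ G' P') y u v := by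
  unfold ricciLocal
  simp only [curvature_congr (quarterCoeff_congr lam₁ lam₂ h hP) quarterCoeff_zero_left]

end Congruence

/-! ### From manifolds to charts -/

section Charts

variable {E : Type*} [NormedAddCommGroup E] [NormedSpace ℝ E]
  {H : Type*} [TopologicalSpace H] {J : ModelWithCorners ℝ E H}
  {M : Type*} [TopologicalSpace M] [ChartedSpace H M]

theorem coordMetric_apply (g : MetricField J M) (x : M) (y u v : E) :
    coordMetric J g x y u v = g ((extChartAt J x).symm y)
      (coordChange J x ((extChartAt J x).symm y) ((extChartAt J x).symm y) u)
      (coordChange J x ((extChartAt J x).symm y) ((extChartAt J x).symm y) v) := rfl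

variable [IsManifold J ∞ M]

theorem isManifold_one : IsManifold J 1 M := IsManifold.of_le (n := ∞) (by norm_cast)

theorem coordChange_self {x z : M} (hx : z ∈ (extChartAt J x).source) (v : E) :
    coordChange J x x z v = v := by
  have := isManifold_one (J := J) (M := M)
  exact tangentCoordChange_self (I := J) hx

theorem coordChange_coordChange {x x' z : M} (hx : z ∈ (extChartAt J x).source)
    (hx' : z ∈ (extChartAt J x').source) (v : E) :
    coordChange J x' x z (coordChange J x x' z v) = v := by
  have := isManifold_one (J := J) (M := M)
  exact (tangentCoordChange_comp (I := J) ⟨⟨hx, hx'⟩, hx⟩).trans (tangentCoordChange_self (I := J) hx)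

theorem coordMetric_self (g : MetricField J M) (x : M) (u v : TangentSpace J x) :
    coordMetric J g x (extChartAt J x x) u v = g x u v := by
  -- Inverting the chart at its own image of x returns x only by a propositional equality, and the
  -- type of `g z` depends on z; hence the generalization.
  have h (z : M) (hz : z = x) : g z (coordChange J x z z u) (coordChange J x z z v) = g x u v := by
    subst hz
    have hx := mem_extChartAt_source (I := J) z
    exact congrArg₂ (fun a c => g z a c) (coordChange_self hx u) (coordChange_self hx v)
  exact h _ (extChartAt_to_inv (I := J) x)

theorem coordField_self (P : ∀ x : M, TangentSpace J x) (x : M) :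
    coordField J P x (extChartAt J x x) = P x := by
  have hx := mem_extChartAt_source (I := J) x
  simp only [coordField]
  rw [extChartAt_to_inv (I := J) x]
  exact coordChange_self hx _

variable [J.Boundaryless]

theorem hasFDerivAt_coordChange {x x' z : M} (hx : z ∈ (extChartAt J x).source)
    (hx' : z ∈ (extChartAt J x').source) :
    HasFDerivAt (extChartAt J x' ∘ (extChartAt J x).symm) (coordChange J x x' z)
      (extChartAt J x z) := by
  have := isManifold_one (J := J) (M := M)
  have h := hasFDerivWithinAt_tangentCoordChange (I := J) ⟨hx, hx'⟩
  rw [J.range_eq_univ, hasFDerivWithinAt_univ] at h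
  exact h

theorem IsPseudoRiemannian.isMetricAt {g : MetricField J M} (hg : IsPseudoRiemannian J g) (x : M) :
    IsMetricAt (coordMetric J g x) (extChartAt J x x) where
  symm := by
    refine Eventually.of_forall fun z v w => ?_
    exact hg.symm _ _ _
  nondegenerate := by
    filter_upwards [extChartAt_target_mem_nhds (I := J) x] with z hz v hv
    have h1 := (extChartAt J x).map_target hz
    have h2 := mem_extChartAt_source (I := J) ((extChartAt J x).symm z)
    have h3 : coordChange J x ((extChartAt J x).symm z) ((extChartAt J x).symm z) v = 0 := by
      refine hg.nondegenerate ((extChartAt J x).symm z) _ fun w => ?_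
      refine Eq.trans ?_ (hv (coordChange J ((extChartAt J x).symm z) x
        ((extChartAt J x).symm z) w))
      exact congrArg (fun a => g ((extChartAt J x).symm z)
        (coordChange J x ((extChartAt J x).symm z) ((extChartAt J x).symm z) v) a)
        (coordChange_coordChange h2 h1 w).symm
    rw [← coordChange_coordChange h1 h2 v, h3, map_zero]
  smooth := by
    filter_upwards [(isOpen_extChartAt_target (I := J) x).mem_nhds (mem_extChartAt_target x)]
      with z hz
    exact (hg.smooth x).contDiffAt ((isOpen_extChartAt_target (I := J) x).mem_nhds hz)

/-- The coordinate field is the section `P` read in the tangent bundle's trivialization at x, where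
smoothness of a section is tested. -/
theorem differentiableAt_coordField {P : ∀ x : M, TangentSpace J x}
    (hP : ContMDiff J J.tangent ∞ (fun p => (⟨p, P p⟩ : TangentBundle J M))) (x : M) :
    DifferentiableAt ℝ (coordField J P x) (extChartAt J x x) := by
  have := isManifold_one (J := J) (M := M)
  have h1 := (Bundle.contMDiffAt_section (F := E) (E := TangentSpace J) x).1
    (hP.of_le (m := 1) (by norm_cast) x)
  have h2 := (contMDiffAt_iff.1 h1).2
  rw [J.range_eq_univ, contDiffWithinAt_univ] at h2
  exact h2.differentiableAt (by simp)

end Charts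

theorem prodMap_pi_single {ι : Type*} [DecidableEq ι] {V : ι → Type*}
    [∀ i, NormedAddCommGroup (V i)] [∀ i, NormedSpace ℝ (V i)] (A : ∀ i, V i →L[ℝ] V i) (r : ι)
    (v : V r) :
    (ContinuousLinearMap.id ℝ ℝ).prodMap (ContinuousLinearMap.pi fun i =>
        (A i).comp (ContinuousLinearMap.proj i)) (0, Pi.single r v) = (0, Pi.single r (A r v)) := by
  refine Prod.ext rfl (funext fun i => ?_)
  by_cases hi : i = r
  · subst hi; simp
  · simp [hi]

/-! ### Product charts of the warped product -/

section WarpedCharts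

variable {m : ℕ} {l : Fin m → ℕ} {F : Fin m → Type*} [∀ i, TopologicalSpace (F i)]
  [∀ i, ChartedSpace (EuclideanSpace ℝ (Fin (l i))) (F i)] {I : TopologicalSpace.Opens ℝ}

theorem coe_extChartAt_opens_symm (p : I) {s : ℝ} (hs : s ∈ I) :
    ((extChartAt 𝓘(ℝ, ℝ) p).symm s : ℝ) = s := by
  have h : (⟨s, hs⟩ : I) ∈ (extChartAt 𝓘(ℝ, ℝ) p).source := by
    simp [TopologicalSpace.Opens.chartAt_eq]
    trivial
  exact congrArg Subtype.val ((extChartAt 𝓘(ℝ, ℝ) p).left_inv h)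

theorem extChartAt_warped_apply (x q : I × ∀ i, F i) :
    extChartAt (warpedModel l) x q
      = ((q.1 : ℝ), fun i => extChartAt (𝓡 (l i)) (x.2 i) (q.2 i)) := rfl

theorem extChartAt_warped_symm (x : I × ∀ i, F i) (y : ℝ × ∀ i, EuclideanSpace ℝ (Fin (l i))) :
    (extChartAt (warpedModel l) x).symm y
      = ((extChartAt 𝓘(ℝ, ℝ) x.1).symm y.1, fun i => (extChartAt (𝓡 (l i)) (x.2 i)).symm (y.2 i)) :=
  rfl

theorem range_warpedModel : Set.range (warpedModel l) = Set.univ := by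
  refine Set.range_eq_univ.2 fun y => ⟨y, rfl⟩

theorem warpedMetric_eq_warpedForm (b : Fin m → ℝ → ℝ) (gF : ∀ i, MetricField (𝓡 (l i)) (F i))
    (z : I × ∀ i, F i) :
    warpedMetric I b gF z = warpedForm (V := fun i => EuclideanSpace ℝ (Fin (l i)))
      (fun i => b i z.1) (fun i => gF i (z.2 i)) := rfl

theorem warpedMetric_apply (b : Fin m → ℝ → ℝ) (gF : ∀ i, MetricField (𝓡 (l i)) (F i))
    (z : I × ∀ i, F i) (u v : TangentSpace (warpedModel l) z) :
    warpedMetric I b gF z u v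
      = -(u.1 * v.1) + ∑ i, b i z.1 ^ 2 * gF i (z.2 i) (u.2 i) (v.2 i) := by
  rw [warpedMetric_eq_warpedForm]
  exact warpedForm_apply _ _ _ _

theorem eventually_mem_target (x : I × ∀ i, F i) :
    ∀ᶠ y in 𝓝 (extChartAt (warpedModel l) x x), y.1 ∈ I ∧
      ∀ i, y.2 i ∈ (extChartAt (𝓡 (l i)) (x.2 i)).target := by
  refine (continuous_fst.continuousAt.eventually (I.isOpen.mem_nhds x.1.2)).and
    (eventually_all.2 fun i => ?_)
  exact (tendsto_snd_apply _ i).eventually (extChartAt_target_mem_nhds (x.2 i))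

variable [∀ i, IsManifold (𝓡 (l i)) ∞ (F i)]

theorem coordChange_warped {x x' z : I × ∀ i, F i}
    (hx : ∀ i, z.2 i ∈ (extChartAt (𝓡 (l i)) (x.2 i)).source)
    (hx' : ∀ i, z.2 i ∈ (extChartAt (𝓡 (l i)) (x'.2 i)).source) :
    coordChange (warpedModel l) x x' z
      = (ContinuousLinearMap.id ℝ ℝ).prodMap (ContinuousLinearMap.pi fun i =>
        (coordChange (𝓡 (l i)) (x.2 i) (x'.2 i) (z.2 i)).comp (ContinuousLinearMap.proj i)) := by
  rw [coordChange, range_warpedModel, fderivWithin_univ]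
  refine HasFDerivAt.fderiv ?_
  have h1 : HasFDerivAt (fun y : ℝ × ∀ i, EuclideanSpace ℝ (Fin (l i)) => (y.1, fun i =>
      (extChartAt (𝓡 (l i)) (x'.2 i) ∘ (extChartAt (𝓡 (l i)) (x.2 i)).symm) (y.2 i)))
      ((ContinuousLinearMap.id ℝ ℝ).prodMap (ContinuousLinearMap.pi fun i =>
        (coordChange (𝓡 (l i)) (x.2 i) (x'.2 i) (z.2 i)).comp (ContinuousLinearMap.proj i)))
      (extChartAt (warpedModel l) x z) := by
    have hy (i : Fin m) : (extChartAt (warpedModel l) x z).2 i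
        = extChartAt (𝓡 (l i)) (x.2 i) (z.2 i) := rfl
    generalize extChartAt (warpedModel l) x z = y₀ at hy ⊢
    refine hasFDerivAt_fst.prodMk (hasFDerivAt_pi'' fun i => ?_)
    have h2 : HasFDerivAt (fun y : ℝ × ∀ i, EuclideanSpace ℝ (Fin (l i)) => y.2 i)
        ((ContinuousLinearMap.proj (R := ℝ) (φ := fun i => EuclideanSpace ℝ (Fin (l i))) i).comp
          (ContinuousLinearMap.snd ℝ ℝ _)) y₀ :=
      ((ContinuousLinearMap.proj (R := ℝ) (φ := fun i => EuclideanSpace ℝ (Fin (l i))) i).comp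
        (ContinuousLinearMap.snd ℝ ℝ _)).hasFDerivAt
    have h3 : HasFDerivAt (extChartAt (𝓡 (l i)) (x'.2 i) ∘ (extChartAt (𝓡 (l i)) (x.2 i)).symm)
        (coordChange (𝓡 (l i)) (x.2 i) (x'.2 i) (z.2 i)) (y₀.2 i) := by
      rw [hy]
      exact hasFDerivAt_coordChange (hx i) (hx' i)
    exact HasFDerivAt.comp y₀ h3 h2
  refine h1.congr_of_eventuallyEq ?_
  -- The inverse chart of `I` inverts the inclusion only over `I`, so the transition map is a
  -- product of transition maps only locally.
  have hI : ∀ᶠ y in 𝓝 (extChartAt (warpedModel l) x z), y.1 ∈ I :=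
    continuous_fst.continuousAt.eventually (I.isOpen.mem_nhds z.1.2)
  filter_upwards [hI] with y hy
  rw [Function.comp_apply, extChartAt_warped_symm, extChartAt_warped_apply]
  exact Prod.ext (coe_extChartAt_opens_symm _ hy) rfl

theorem coordMetric_warped (b : Fin m → ℝ → ℝ) (gF : ∀ i, MetricField (𝓡 (l i)) (F i))
    (x : I × ∀ i, F i) :
    coordMetric (warpedModel l) (warpedMetric I b gF) x
      =ᶠ[𝓝 (extChartAt (warpedModel l) x x)]
        localWarped b fun i => coordMetric (𝓡 (l i)) (gF i) (x.2 i) := by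
  filter_upwards [eventually_mem_target x] with y hy
  refine ContinuousLinearMap.ext fun u => ContinuousLinearMap.ext fun v => ?_
  have h1 := coordChange_warped (x := x) (x' := (extChartAt (warpedModel l) x).symm y)
    (z := (extChartAt (warpedModel l) x).symm y)
    (fun i => (extChartAt (𝓡 (l i)) (x.2 i)).map_target (hy.2 i))
    (fun i => mem_extChartAt_source (I := 𝓡 (l i)) _)
  rw [coordMetric_apply, h1]
  refine (warpedMetric_apply b gF _ _ _).trans ?_
  rw [localWarped, warpedForm_apply]
  congr 1
  refine Finset.sum_congr rfl fun i _ => ?_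
  have h2 := coe_extChartAt_opens_symm x.1 hy.1
  rw [extChartAt_warped_symm]
  simp only [h2]
  rfl

theorem coordField_lift (r : Fin m) (P : ∀ p : F r, TangentSpace (𝓡 (l r)) p) (x : I × ∀ i, F i) :
    coordField (warpedModel l) (liftField I r P) x
      =ᶠ[𝓝 (extChartAt (warpedModel l) x x)] localLift r (coordField (𝓡 (l r)) P (x.2 r)) := by
  filter_upwards [eventually_mem_target x] with y hy
  have h1 := coordChange_warped (x := (extChartAt (warpedModel l) x).symm y) (x' := x)
    (z := (extChartAt (warpedModel l) x).symm y)
    (fun i => mem_extChartAt_source (I := 𝓡 (l i)) _)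
    (fun i => (extChartAt (𝓡 (l i)) (x.2 i)).map_target (hy.2 i))
  simp only [coordField]
  rw [h1]
  exact prodMap_pi_single _ r _

end WarpedCharts

/-! ### The Ricci tensor of the modified connection on the warped product -/

section WarpedRicciBar

/-- Minus the coefficient of `g i` in the Ricci tensor of a multiply warped product over an
interval, for warping functions `b` and fibers of dimensions `l`. -/
def fiberCoeff {ι : Type*} [Fintype ι] [DecidableEq ι] (l : ι → ℕ) (b : ι → ℝ → ℝ) (i : ι)
    (t : ℝ) : ℝ :=
  b i t * deriv (deriv (b i)) t
    + b i t * deriv (b i) t * ∑ s ∈ Finset.univ.erase i, (l s : ℝ) * (deriv (b s) t / b s t)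
    + ((l i : ℝ) - 1) * deriv (b i) t ^ 2

variable {m : ℕ} {l : Fin m → ℕ} {F : Fin m → Type*} [∀ i, TopologicalSpace (F i)]
  [∀ i, ChartedSpace (EuclideanSpace ℝ (Fin (l i))) (F i)] {I : TopologicalSpace.Opens ℝ}
  [∀ i, IsManifold (𝓡 (l i)) ∞ (F i)]
  {gF : ∀ i, MetricField (𝓡 (l i)) (F i)} {b : Fin m → ℝ → ℝ}
  {r : Fin m} {P : ∀ p : F r, TangentSpace (𝓡 (l r)) p}

theorem isWarpedAt_coordMetric (hgF : ∀ i, IsPseudoRiemannian (𝓡 (l i)) (gF i))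
    (hb : ∀ i, ContDiffOn ℝ ∞ (b i) I) (hbpos : ∀ i, ∀ t ∈ I, 0 < b i t) (x : I × ∀ i, F i) :
    IsWarpedAt b (fun i => coordMetric (𝓡 (l i)) (gF i) (x.2 i))
      (extChartAt (warpedModel l) x x) where
  smooth i := by
    filter_upwards [I.isOpen.mem_nhds x.1.2] with t ht
    exact (hb i).contDiffAt (I.isOpen.mem_nhds ht)
  pos i := by
    filter_upwards [I.isOpen.mem_nhds x.1.2] with t ht using hbpos i t ht
  metric i := (hgF i).isMetricAt (x.2 i)

theorem localWarped_coordMetric (b : Fin m → ℝ → ℝ) (gF : ∀ i, MetricField (𝓡 (l i)) (F i))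
    (x : I × ∀ i, F i) (u v : TangentSpace (warpedModel l) x) :
    localWarped b (fun i => coordMetric (𝓡 (l i)) (gF i) (x.2 i)) (extChartAt (warpedModel l) x x)
      u v = warpedMetric I b gF x u v := by
  rw [warpedMetric_apply]
  refine (warpedForm_apply _ _ _ _).trans ?_
  congr 1
  exact Finset.sum_congr rfl fun i _ => congrArg (b i x.1 ^ 2 * ·) (coordMetric_self _ _ _ _)

theorem coordMetric_coordField {E H M : Type*} [NormedAddCommGroup E] [NormedSpace ℝ E]
    [TopologicalSpace H] {J : ModelWithCorners ℝ E H} [TopologicalSpace M] [ChartedSpace H M]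
    [IsManifold J ∞ M] (g : MetricField J M) (P : ∀ x : M, TangentSpace J x) (x : M)
    (u : TangentSpace J x) :
    coordMetric J g x (extChartAt J x x) u (coordField J P x (extChartAt J x x)) = g x u (P x) := by
  rw [coordField_self]
  exact coordMetric_self _ _ _ _

theorem nabla_warped (b : Fin m → ℝ → ℝ) (gF : ∀ i, MetricField (𝓡 (l i)) (F i))
    (P : ∀ p : F r, TangentSpace (𝓡 (l r)) p) (x : I × ∀ i, F i)
    (u : TangentSpace (warpedModel l) x) :
    nabla (warpedModel l) (warpedMetric I b gF) (liftField I r P) x u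
      = covDeriv (christoffel (localWarped b fun i => coordMetric (𝓡 (l i)) (gF i) (x.2 i)))
        (fun _ => u) (localLift r (coordField (𝓡 (l r)) P (x.2 r)))
        (extChartAt (warpedModel l) x x) :=
  covDeriv_christoffel_congr (coordMetric_warped b gF x) (coordField_lift r P x) _

theorem warpedMetric_nabla (hgF : ∀ i, IsPseudoRiemannian (𝓡 (l i)) (gF i))
    (hb : ∀ i, ContDiffOn ℝ ∞ (b i) I) (hbpos : ∀ i, ∀ t ∈ I, 0 < b i t)
    (hP : ContMDiff (𝓡 (l r)) (𝓡 (l r)).tangent ∞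
      (fun p => (⟨p, P p⟩ : TangentBundle (𝓡 (l r)) (F r))))
    (x : I × ∀ i, F i) (u v : TangentSpace (warpedModel l) x) :
    warpedMetric I b gF x v (nabla (warpedModel l) (warpedMetric I b gF) (liftField I r P) x u)
      = -(v.1 * (b r x.1 * deriv (b r) x.1 * gF r (x.2 r) (u.2 r) (P (x.2 r))))
        + b r x.1 ^ 2 * gF r (x.2 r) (v.2 r) (nabla (𝓡 (l r)) (gF r) P (x.2 r) (u.2 r))
        + b r x.1 * deriv (b r) x.1 * u.1 * gF r (x.2 r) (v.2 r) (P (x.2 r)) := by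
  have h := (isWarpedAt_coordMetric hgF hb hbpos x).localWarped_covDeriv (r := r)
    (differentiableAt_coordField hP (x.2 r)) u v
  rw [← localWarped_coordMetric, nabla_warped]
  -- Values in coordinates and values on tangent spaces agree up to unfolding `TangentSpace`;
  -- stating the substitution for real numbers avoids rewriting inside dependent types.
  have key (A A' B B' C C' : ℝ) (hA : A = A') (hB : B = B') (hC : C = C') :
      -(v.1 * (b r x.1 * deriv (b r) x.1 * A)) + b r x.1 ^ 2 * B
        + b r x.1 * deriv (b r) x.1 * u.1 * C
      = -(v.1 * (b r x.1 * deriv (b r) x.1 * A')) + b r x.1 ^ 2 * B'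
        + b r x.1 * deriv (b r) x.1 * u.1 * C' := by rw [hA, hB, hC]
  exact h.trans (key _ _ _ _ _ _ (coordMetric_coordField _ _ _ _) (coordMetric_self _ _ _ _)
    (coordMetric_coordField _ _ _ _))

/-- The Ricci tensor of `∇̄` on the warped product, in terms of the fibers. -/
theorem ricciBar_warped (hgF : ∀ i, IsPseudoRiemannian (𝓡 (l i)) (gF i))
    (hb : ∀ i, ContDiffOn ℝ ∞ (b i) I) (hbpos : ∀ i, ∀ t ∈ I, 0 < b i t)
    (hP : ContMDiff (𝓡 (l r)) (𝓡 (l r)).tangent ∞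
      (fun p => (⟨p, P p⟩ : TangentBundle (𝓡 (l r)) (F r))))
    (hPunit : ∀ p, gF r p (P p) (P p) = 1) (lam₁ lam₂ : ℝ) {n : ℕ} (hn : n = 1 + ∑ i, l i)
    (x : I × ∀ i, F i) (u v : TangentSpace (warpedModel l) x) :
    ricciBar (warpedModel l) lam₁ lam₂ (warpedMetric I b gF) (liftField I r P) x u v
      = ∑ i, ricci (𝓡 (l i)) (gF i) (x.2 i) (u.2 i) (v.2 i)
        + u.1 * v.1 * ∑ i, (l i : ℝ) * (deriv (deriv (b i)) x.1 / b i x.1)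
        - ∑ i, fiberCoeff l b i x.1 * gF i (x.2 i) (u.2 i) (v.2 i)
        + (((n : ℝ) - 1) * lam₁ - lam₂) * warpedMetric I b gF x v
            (nabla (warpedModel l) (warpedMetric I b gF) (liftField I r P) x u)
        + (lam₂ * divergence (𝓡 (l r)) (gF r) P (x.2 r)
            + (((n : ℝ) - 1) * lam₁ * lam₂ - lam₂ ^ 2) * b r x.1 ^ 2) * warpedMetric I b gF x u v
        + (lam₂ ^ 2 - ((n : ℝ) - 1) * lam₁ ^ 2)
          * (b r x.1 ^ 2 * gF r (x.2 r) (u.2 r) (P (x.2 r)))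
          * (b r x.1 ^ 2 * gF r (x.2 r) (v.2 r) (P (x.2 r))) := by
  have hW := isWarpedAt_coordMetric hgF hb hbpos x
  have hQ := differentiableAt_coordField hP (x.2 r)
  have hfin : (Module.finrank ℝ (ℝ × ∀ i, EuclideanSpace ℝ (Fin (l i))) : ℝ) = n := by
    rw [hn, Module.finrank_prod, Module.finrank_pi_fintype]
    simp
  have h := hW.ricciLocal_quarterCoeff_eq (r := r) hQ lam₁ lam₂ hfin u v
  refine (ricciLocal_quarterCoeff_congr lam₁ lam₂ (coordMetric_warped b gF x)
    (coordField_lift r P x) u v).trans (h.trans ?_)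
  have hsum : ∑ i, (-(b i x.1 * deriv (deriv (b i)) x.1)
      - b i x.1 * deriv (b i) x.1 * ∑ s ∈ Finset.univ.erase i,
        (Module.finrank ℝ (EuclideanSpace ℝ (Fin (l s))) : ℝ) * (deriv (b s) x.1 / b s x.1)
      - ((Module.finrank ℝ (EuclideanSpace ℝ (Fin (l i))) : ℝ) - 1) * deriv (b i) x.1 ^ 2)
        * coordMetric (𝓡 (l i)) (gF i) (x.2 i) ((extChartAt (warpedModel l) x x).2 i)
          (u.2 i) (v.2 i)
      = - ∑ i, fiberCoeff l b i x.1 * gF i (x.2 i) (u.2 i) (v.2 i) := by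
    rw [← Finset.sum_neg_distrib]
    refine Finset.sum_congr rfl fun i _ => ?_
    have h1 : coordMetric (𝓡 (l i)) (gF i) (x.2 i) ((extChartAt (warpedModel l) x x).2 i)
      (u.2 i) (v.2 i) = gF i (x.2 i) (u.2 i) (v.2 i) := coordMetric_self _ _ _ _
    rw [← h1]
    simp only [finrank_euclideanSpace_fin, fiberCoeff]
    ring
  have hS : ∑ i, (Module.finrank ℝ (EuclideanSpace ℝ (Fin (l i))) : ℝ)
      * (deriv (deriv (b i)) x.1 / b i x.1)
      = ∑ i, (l i : ℝ) * (deriv (deriv (b i)) x.1 / b i x.1) := by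
    simp only [finrank_euclideanSpace_fin]
  have hPP : coordMetric (𝓡 (l r)) (gF r) (x.2 r) ((extChartAt (warpedModel l) x x).2 r)
      (coordField (𝓡 (l r)) P (x.2 r) ((extChartAt (warpedModel l) x x).2 r))
      (coordField (𝓡 (l r)) P (x.2 r) ((extChartAt (warpedModel l) x x).2 r)) = 1 := by
    have h1 : coordField (𝓡 (l r)) P (x.2 r) ((extChartAt (warpedModel l) x x).2 r) = P (x.2 r) :=
      coordField_self P (x.2 r)
    rw [h1]
    exact (coordMetric_self _ _ _ _).trans (hPunit (x.2 r))
  have key {A S S' B B' N N' D g g' U U' V V' R : ℝ} (hS : S = S') (hB : B = -B') (hN : N = N')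
      (hg : g = g') (hU : U = U') (hV : V = V') (hR : R = 1) :
      A + u.1 * v.1 * S + B + (((n : ℝ) - 1) * lam₁ - lam₂) * N + lam₂ * D * g
        + (lam₂ ^ 2 - ((n : ℝ) - 1) * lam₁ ^ 2) * (b r x.1 ^ 2 * U) * (b r x.1 ^ 2 * V)
        + (((n : ℝ) - 1) * lam₁ * lam₂ - lam₂ ^ 2) * (b r x.1 ^ 2 * R) * g
      = A + u.1 * v.1 * S' - B' + (((n : ℝ) - 1) * lam₁ - lam₂) * N'
        + (lam₂ * D + (((n : ℝ) - 1) * lam₁ * lam₂ - lam₂ ^ 2) * b r x.1 ^ 2) * g'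
        + (lam₂ ^ 2 - ((n : ℝ) - 1) * lam₁ ^ 2) * (b r x.1 ^ 2 * U') * (b r x.1 ^ 2 * V') := by
    rw [hS, hB, hN, hg, hU, hV, hR]
    ring
  refine key hS hsum ?_ (localWarped_coordMetric b gF x u v) (coordMetric_coordField _ _ _ _)
    (coordMetric_coordField _ _ _ _) ?_
  · rw [← localWarped_coordMetric, nabla_warped]
  · exact hPP

/-- The Ricci tensor vanishes when its first argument does. -/
theorem ricci_zero_left {E H M : Type*} [NormedAddCommGroup E] [NormedSpace ℝ E]
    [FiniteDimensional ℝ E] [TopologicalSpace H] {J : ModelWithCorners ℝ E H} [TopologicalSpace M]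
    [ChartedSpace H M] (g : MetricField J M) (x : M) (v : TangentSpace J x) :
    ricci J g x 0 v = 0 :=
  ricciLocal_zero_left (E := E) (coordMetric J g x) _ v

end WarpedRicciBar

/-! ### Splitting the Einstein equation, and the Bianchi argument -/

section Einstein

/-- Decomposition of the Einstein equation along the base, the mixed directions and the fibers. -/
theorem forall_bilinear_eq_iff {ι : Type*} [Fintype ι] [DecidableEq ι] {V : ι → Type*}
    [∀ i, AddCommGroup (V i)] {r : ι} {ρ γ : ∀ i, V i → V i → ℝ} {N : V r → V r → ℝ} {π : V r → ℝ}
    {w : V r} {Φ β : ι → ℝ} {S K f A c α : ℝ} (hρ : ∀ i v, ρ i 0 v = 0) (hγ : ∀ i v, γ i 0 v = 0)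
    (hN : ∀ v, N 0 v = 0) (hπ : π 0 = 0) (hw : π w ≠ 0) :
    (∀ u v : ℝ × ∀ i, V i,
      ∑ i, ρ i (u.2 i) (v.2 i) + u.1 * v.1 * S - ∑ i, Φ i * γ i (u.2 i) (v.2 i)
        + K * (-(v.1 * (f * π (u.2 r))) + β r ^ 2 * N (u.2 r) (v.2 r) + f * u.1 * π (v.2 r))
        + A * (-(u.1 * v.1) + ∑ i, β i ^ 2 * γ i (u.2 i) (v.2 i))
        + c * (β r ^ 2 * π (u.2 r)) * (β r ^ 2 * π (v.2 r))
      = α * (-(u.1 * v.1) + ∑ i, β i ^ 2 * γ i (u.2 i) (v.2 i))) ↔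
    S = A - α ∧ K * f = 0 ∧
      (∀ i, i ≠ r → ∀ u v, ρ i u v - Φ i * γ i u v + A * (β i ^ 2 * γ i u v)
        = α * (β i ^ 2 * γ i u v)) ∧
      (∀ u v, ρ r u v - Φ r * γ r u v + K * (β r ^ 2 * N u v) + A * (β r ^ 2 * γ r u v)
        + c * (β r ^ 2 * π u) * (β r ^ 2 * π v) = α * (β r ^ 2 * γ r u v)) := by
  have hsum (h : ∀ i, V i → V i → ℝ) (hh : ∀ i v, h i 0 v = 0) (i : ι) (a d : V i) :
      ∑ j, h j ((Pi.single i a : ∀ j, V j) j) ((Pi.single i d : ∀ j, V j) j) = h i a d := by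
    rw [Finset.sum_eq_single i (fun j _ hj => by simp [hj, hh]) (by simp)]
    simp
  constructor
  · intro h
    refine ⟨?_, ?_, fun i hi u v => ?_, fun u v => ?_⟩
    · have h1 := h (1, 0) (1, 0)
      simp [hρ, hγ, hN, hπ] at h1
      linarith
    -- Pairing time with `w`, which will be P, leaves K f π(w) = 0, and π(w) ≠ 0.
    · have h1 := h (1, 0) (0, Pi.single r w)
      simp [hρ, hγ, hN, hπ] at h1
      rcases h1 with h1 | h1 | h1
      · simp [h1]
      · simp [h1]
      · exact absurd h1 hw
    · have h1 := h (0, Pi.single i u) (0, Pi.single i v)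
      rw [hsum ρ hρ, hsum (fun i u v => Φ i * γ i u v) (by simp [hγ]),
        hsum (fun i u v => β i ^ 2 * γ i u v) (by simp [hγ])] at h1
      simp [hi.symm, hN, hπ] at h1
      linarith
    · have h1 := h (0, Pi.single r u) (0, Pi.single r v)
      rw [hsum ρ hρ, hsum (fun i u v => Φ i * γ i u v) (by simp [hγ]),
        hsum (fun i u v => β i ^ 2 * γ i u v) (by simp [hγ])] at h1
      simp at h1
      linarith
  · rintro ⟨h0, h1, h2, h3⟩ u v
    -- The fiber equations annihilate every summand with i ≠ r; the remaining one is completed by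
    -- the ∇P and π ⊗ π terms of `h3`.
    have h4 : ∑ i, (ρ i (u.2 i) (v.2 i) - Φ i * γ i (u.2 i) (v.2 i)
        + (A - α) * (β i ^ 2 * γ i (u.2 i) (v.2 i)))
        = ρ r (u.2 r) (v.2 r) - Φ r * γ r (u.2 r) (v.2 r)
        + (A - α) * (β r ^ 2 * γ r (u.2 r) (v.2 r)) :=
      Finset.sum_eq_single r (fun i _ hi => by linear_combination h2 i hi (u.2 i) (v.2 i)) (by simp)
    rw [Finset.sum_add_distrib, Finset.sum_sub_distrib, ← Finset.mul_sum] at h4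
    linear_combination h4 + h3 (u.2 r) (v.2 r) + u.1 * v.1 * h0
      + (u.1 * π (v.2 r) - v.1 * π (u.2 r)) * h1

variable {m : ℕ} {l : Fin m → ℕ} {F : Fin m → Type*} [∀ i, TopologicalSpace (F i)]
  [∀ i, ChartedSpace (EuclideanSpace ℝ (Fin (l i))) (F i)] {I : TopologicalSpace.Opens ℝ}
  [∀ i, IsManifold (𝓡 (l i)) ∞ (F i)]
  {gF : ∀ i, MetricField (𝓡 (l i)) (F i)} {b : Fin m → ℝ → ℝ}
  {r : Fin m} {P : ∀ p : F r, TangentSpace (𝓡 (l r)) p}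

theorem nabla_zero {E H M : Type*} [NormedAddCommGroup E] [NormedSpace ℝ E]
    [TopologicalSpace H] {J : ModelWithCorners ℝ E H} [TopologicalSpace M]
    [ChartedSpace H M] (g : MetricField J M) (P : ∀ x : M, TangentSpace J x) (x : M) :
    nabla J g P x 0 = 0 := by
  have h : covDeriv (E := E) (christoffel (coordMetric J g x)) (fun _ => 0) (coordField J P x)
      (extChartAt J x x) = 0 := by
    simp [covDeriv, christoffel_zero_left]
  exact h

theorem ricciBar_warped_eq_iff (hgF : ∀ i, IsPseudoRiemannian (𝓡 (l i)) (gF i))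
    (hb : ∀ i, ContDiffOn ℝ ∞ (b i) I) (hbpos : ∀ i, ∀ t ∈ I, 0 < b i t)
    (hP : ContMDiff (𝓡 (l r)) (𝓡 (l r)).tangent ∞
      (fun p => (⟨p, P p⟩ : TangentBundle (𝓡 (l r)) (F r))))
    (hPunit : ∀ p, gF r p (P p) (P p) = 1) (lam₁ lam₂ : ℝ) {n : ℕ} (hn : n = 1 + ∑ i, l i)
    (α : ℝ) (x : I × ∀ i, F i) :
    (∀ u v : TangentSpace (warpedModel l) x,
      ricciBar (warpedModel l) lam₁ lam₂ (warpedMetric I b gF) (liftField I r P) x u v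
        = α * warpedMetric I b gF x u v) ↔
    ∑ i, (l i : ℝ) * (deriv (deriv (b i)) x.1 / b i x.1)
        = lam₂ * divergence (𝓡 (l r)) (gF r) P (x.2 r)
          + (((n : ℝ) - 1) * lam₁ * lam₂ - lam₂ ^ 2) * b r x.1 ^ 2 - α ∧
      (((n : ℝ) - 1) * lam₁ - lam₂) * (b r x.1 * deriv (b r) x.1) = 0 ∧
      (∀ i, i ≠ r → ∀ u v : TangentSpace (𝓡 (l i)) (x.2 i),
        ricci (𝓡 (l i)) (gF i) (x.2 i) u v - fiberCoeff l b i x.1 * gF i (x.2 i) u v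
          + (lam₂ * divergence (𝓡 (l r)) (gF r) P (x.2 r)
            + (((n : ℝ) - 1) * lam₁ * lam₂ - lam₂ ^ 2) * b r x.1 ^ 2)
            * (b i x.1 ^ 2 * gF i (x.2 i) u v)
        = α * (b i x.1 ^ 2 * gF i (x.2 i) u v)) ∧
      (∀ u v : TangentSpace (𝓡 (l r)) (x.2 r),
        ricci (𝓡 (l r)) (gF r) (x.2 r) u v - fiberCoeff l b r x.1 * gF r (x.2 r) u v
          + (((n : ℝ) - 1) * lam₁ - lam₂)
            * (b r x.1 ^ 2 * gF r (x.2 r) v (nabla (𝓡 (l r)) (gF r) P (x.2 r) u))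
          + (lam₂ * divergence (𝓡 (l r)) (gF r) P (x.2 r)
            + (((n : ℝ) - 1) * lam₁ * lam₂ - lam₂ ^ 2) * b r x.1 ^ 2)
            * (b r x.1 ^ 2 * gF r (x.2 r) u v)
          + (lam₂ ^ 2 - ((n : ℝ) - 1) * lam₁ ^ 2)
            * (b r x.1 ^ 2 * gF r (x.2 r) u (P (x.2 r)))
            * (b r x.1 ^ 2 * gF r (x.2 r) v (P (x.2 r)))
        = α * (b r x.1 ^ 2 * gF r (x.2 r) u v)) := by
  refine Iff.trans (forall₂_congr fun u v => ?_) (forall_bilinear_eq_iff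
    (V := fun i => TangentSpace (𝓡 (l i)) (x.2 i))
    (ρ := fun i u v => ricci (𝓡 (l i)) (gF i) (x.2 i) u v) (γ := fun i u v => gF i (x.2 i) u v)
    (N := fun u v => gF r (x.2 r) v (nabla (𝓡 (l r)) (gF r) P (x.2 r) u))
    (π := fun u => gF r (x.2 r) u (P (x.2 r))) (w := P (x.2 r)) (Φ := fun i => fiberCoeff l b i x.1)
    (β := fun i => b i x.1)
    (fun i v => ricci_zero_left _ _ _) (fun i v => by simp) (fun v => by simp [nabla_zero])
    (by simp) (by simp [hPunit]))
  rw [ricciBar_warped hgF hb hbpos hP hPunit lam₁ lam₂ hn, warpedMetric_nabla hgF hb hbpos hP,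
    warpedMetric_apply]

/-- Differentiating the trace of the field equations: the contracted Bianchi identity. -/
theorem sum_mul_eq_zero_of_field_equations {ι : Type*} [Fintype ι] {I : Set ℝ} (hI : IsOpen I)
    {b H H' : ι → ℝ → ℝ} (hbpos : ∀ i, ∀ t ∈ I, 0 < b i t)
    (hb : ∀ i, ∀ t ∈ I, HasDerivAt (b i) (H i t * b i t) t)
    (hH : ∀ i, ∀ t ∈ I, HasDerivAt (H i) (H' i t) t) (l a c : ι → ℝ) (k : ℝ)
    (hfield : ∀ i, ∀ t ∈ I,
      H' i t = -(H i t * ∑ s, l s * H s t) + a i / b i t ^ 2 - k - c i * b i t ^ 2)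
    (htime : ∀ t ∈ I, ∑ i, l i * (H' i t + H i t ^ 2) = -k) {t : ℝ} (ht : t ∈ I) :
    ∑ i, l i * c i * b i t ^ 2 * H i t = 0 := by
  -- Eliminating the H_i' from the time equation leaves a first-order constraint, whose derivative
  -- must vanish.
  have hconst : ∀ t ∈ I, ∑ i, l i * H i t ^ 2 - (∑ i, l i * H i t) ^ 2
      + ∑ i, l i * (a i / b i t ^ 2 - c i * b i t ^ 2) = (∑ i, l i) * k - k := by
    intro t ht
    have h1 := htime t ht
    have h2 : ∑ i, l i * (H' i t + H i t ^ 2)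
        = ∑ i, (l i * H i t ^ 2 - l i * H i t * (∑ s, l s * H s t)
          + l i * (a i / b i t ^ 2 - c i * b i t ^ 2) - l i * k) :=
      Finset.sum_congr rfl fun i _ => by rw [hfield i t ht]; ring
    rw [h2, Finset.sum_sub_distrib, Finset.sum_add_distrib, Finset.sum_sub_distrib,
      ← Finset.sum_mul, ← Finset.sum_mul] at h1
    linear_combination h1
  have hd1 : HasDerivAt (fun t => ∑ i, l i * H i t ^ 2) (∑ i, l i * (2 * H i t * H' i t)) t :=
    HasDerivAt.fun_sum fun i _ => by
      simpa using ((hH i t ht).pow 2).const_mul (l i)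
  have hd2 : HasDerivAt (fun t => (∑ i, l i * H i t) ^ 2)
      (2 * (∑ i, l i * H i t) * ∑ i, l i * H' i t) t := by
    have h := (HasDerivAt.fun_sum fun i (_ : i ∈ Finset.univ) => (hH i t ht).const_mul (l i)).fun_pow 2
    exact h.congr_deriv (by simp)
  have hd3 : HasDerivAt (fun t => ∑ i, l i * (a i / b i t ^ 2 - c i * b i t ^ 2))
      (∑ i, l i * (-2 * (a i / b i t ^ 2) * H i t - 2 * c i * b i t ^ 2 * H i t)) t := by
    refine HasDerivAt.fun_sum fun i _ => ?_
    have hne := (hbpos i t ht).ne'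
    have h1 := (hb i t ht).pow 2
    have h2 := (((hasDerivAt_const t (a i)).div h1 (pow_ne_zero 2 hne)).sub
      (h1.const_mul (c i))).const_mul (l i)
    refine h2.congr_deriv ?_
    simp only [Pi.pow_apply, Nat.cast_ofNat]
    field_simp
    ring
  have hd : HasDerivAt (fun t => ∑ i, l i * H i t ^ 2 - (∑ i, l i * H i t) ^ 2
      + ∑ i, l i * (a i / b i t ^ 2 - c i * b i t ^ 2)) _ t := (hd1.sub hd2).add hd3
  have h0 := hd.unique ((hasDerivAt_const t ((∑ i, l i) * k - k)).congr_of_eventuallyEq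
    (by filter_upwards [hI.mem_nhds ht] with s hs using hconst s hs))
  set Θ := ∑ i, l i * H i t with hΘ
  have h1 : ∑ i, l i * (2 * H i t * H' i t) = ∑ i, (-(2 * Θ * (l i * H i t ^ 2))
      - l i * (-2 * (a i / b i t ^ 2) * H i t - 2 * c i * b i t ^ 2 * H i t)
      - 2 * k * (l i * H i t) - 4 * (l i * c i * b i t ^ 2 * H i t)) :=
    Finset.sum_congr rfl fun i _ => by rw [hfield i t ht]; ring
  have h2 := htime t ht
  rw [Finset.sum_sub_distrib, Finset.sum_sub_distrib, Finset.sum_sub_distrib,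
    Finset.sum_neg_distrib, ← Finset.mul_sum, ← Finset.mul_sum, ← Finset.mul_sum, ← hΘ] at h1
  simp only [mul_add, Finset.sum_add_distrib] at h2
  -- In the differentiated constraint, the field equations cancel the a_i terms, whereas the c_i
  -- terms add up to four times the desired sum; the terms in Θ cancel by the time equation.
  linear_combination (-1 / 4) * h0 + (1 / 4) * h1 - (Θ / 2) * h2

end Einstein

theorem exists_eqOn_const {I : TopologicalSpace.Opens ℝ} (hI : (I : Set ℝ).OrdConnected)
    {f : ℝ → ℝ} (hf : DifferentiableOn ℝ f I) (hf' : ∀ t ∈ I, deriv f t = 0) :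
    ∃ β, ∀ t ∈ I, f t = β :=
  I.isOpen.exists_is_const_of_deriv_eq_zero hI.isPreconnected hf hf'

theorem deriv_eq_zero_of_eqOn {I : TopologicalSpace.Opens ℝ} {f : ℝ → ℝ} {β : ℝ}
    (hf : ∀ t ∈ I, f t = β) {t : ℝ} (ht : t ∈ I) : deriv f t = 0 := by
  have h : f =ᶠ[𝓝 t] fun _ => β := by
    filter_upwards [I.isOpen.mem_nhds ht] with s hs using hf s hs
  rw [h.deriv_eq, deriv_const]

/-- The field equations with a nonzero source `c` along the fiber `r` force `b r` to be constant. -/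
theorem deriv_eq_zero_of_field_equations {ι : Type*} [Fintype ι] [DecidableEq ι]
    {I : TopologicalSpace.Opens ℝ} {l : ι → ℕ} {b : ι → ℝ → ℝ} {r : ι} (hl : 1 ≤ l r)
    (hb : ∀ i, ContDiffOn ℝ ∞ (b i) I) (hbpos : ∀ i, ∀ t ∈ I, 0 < b i t)
    (a : ι → ℝ) {c k : ℝ} (hc : c ≠ 0)
    (htime : ∀ t ∈ I, ∑ i, (l i : ℝ) * (deriv (deriv (b i)) t / b i t) = -k)
    (hfiber : ∀ i, i ≠ r → ∀ t ∈ I, a i - fiberCoeff l b i t = k * b i t ^ 2)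
    (hr : ∀ t ∈ I, a r - fiberCoeff l b r t - c * b r t ^ 4 = k * b r t ^ 2)
    {t : ℝ} (ht : t ∈ I) : deriv (b r) t = 0 := by
  have hb1 (i : ι) (t : ℝ) (ht : t ∈ I) : HasDerivAt (b i) (deriv (b i) t) t :=
    (((hb i).contDiffAt (I.isOpen.mem_nhds ht)).differentiableAt (by simp)).hasDerivAt
  have hb2 (i : ι) (t : ℝ) (ht : t ∈ I) : HasDerivAt (deriv (b i)) (deriv (deriv (b i)) t) t :=
    ((((hb i).contDiffAt (I.isOpen.mem_nhds ht)).fderiv_right (m := 1)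
      (by norm_cast)).differentiableAt (by simp)).clm_apply
      (differentiableAt_const (1 : ℝ)) |>.hasDerivAt
  have hsum := sum_mul_eq_zero_of_field_equations I.isOpen hbpos
    (H := fun i t => deriv (b i) t / b i t)
    (H' := fun i t => deriv (deriv (b i)) t / b i t - (deriv (b i) t / b i t) ^ 2)
    (fun i t ht => (hb1 i t ht).congr_deriv (by
      have := (hbpos i t ht).ne'
      field_simp))
    (fun i t ht => ((hb2 i t ht).div (hb1 i t ht) (hbpos i t ht).ne').congr_deriv (by
      have := (hbpos i t ht).ne'
      field_simp))
    -- With a source on the fiber r alone, the Bianchi sum reduces to l_r c b_r² (b_r'/b_r) = 0.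
    (fun i => (l i : ℝ)) a (fun i => if i = r then c else 0) k ?_ ?_ ht
  · rw [Finset.sum_eq_single r (fun i _ hi => by simp [hi]) (by simp)] at hsum
    have h1 := (hbpos r t ht).ne'
    have h2 : (l r : ℝ) ≠ 0 := by positivity
    simpa [h1, h2, hc] using hsum
  · intro i t ht
    have hne := (hbpos i t ht).ne'
    have h1 : a i - fiberCoeff l b i t - (if i = r then c else 0) * b i t ^ 4 = k * b i t ^ 2 := by
      split_ifs with h
      · rw [h]; exact hr t ht
      · simpa using hfiber i h t ht
    rw [fiberCoeff] at h1
    -- The i-th term of the full sum gives l_i b_i'²; together with the -b_i'² from H_i' it makes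
    -- the (l_i - 1) b_i'² of `fiberCoeff`.
    rw [← Finset.add_sum_erase _ _ (Finset.mem_univ i)]
    set c' := if i = r then c else 0
    set T := ∑ s ∈ Finset.univ.erase i, (l s : ℝ) * (deriv (b s) t / b s t)
    field_simp
    linear_combination -h1
  · intro t ht
    simpa using htime t ht

/-! ### Lifted vectors in the product metric -/

section Lift

variable {m : ℕ} {l : Fin m → ℕ} {F : Fin m → Type*} [∀ i, TopologicalSpace (F i)]
  [∀ i, ChartedSpace (EuclideanSpace ℝ (Fin (l i))) (F i)] {I : TopologicalSpace.Opens ℝ}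
  {r : Fin m} {P : ∀ p : F r, TangentSpace (𝓡 (l r)) p}

theorem liftVec_fst (x : I × ∀ i, F i) (v : TangentSpace (𝓡 (l r)) (x.2 r)) :
    (liftVec r x v).1 = 0 := rfl

theorem liftVec_snd_self (x : I × ∀ i, F i) (v : TangentSpace (𝓡 (l r)) (x.2 r)) :
    (liftVec r x v).2 r = v :=
  Pi.single_eq_same (M := fun i => EuclideanSpace ℝ (Fin (l i))) r v

theorem liftVec_snd_of_ne (x : I × ∀ i, F i) (v : TangentSpace (𝓡 (l r)) (x.2 r)) {i : Fin m}
    (hi : i ≠ r) : (liftVec r x v).2 i = 0 :=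
  Pi.single_eq_of_ne (M := fun i => EuclideanSpace ℝ (Fin (l i))) hi v

theorem warpedMetric_liftVec (b : Fin m → ℝ → ℝ) (gF : ∀ i, MetricField (𝓡 (l i)) (F i))
    (x : I × ∀ i, F i) (v w : TangentSpace (𝓡 (l r)) (x.2 r)) :
    warpedMetric I b gF x (liftVec r x v) (liftVec r x w) = b r x.1 ^ 2 * gF r (x.2 r) v w := by
  rw [warpedMetric_apply, Finset.sum_eq_single r, liftVec_fst]
  · have h (a a' c c' : TangentSpace (𝓡 (l r)) (x.2 r)) (ha : a = a') (hc : c = c') :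
        -(0 * (liftVec r x w).1) + b r x.1 ^ 2 * gF r (x.2 r) a c
          = b r x.1 ^ 2 * gF r (x.2 r) a' c' := by
      rw [ha, hc]; ring
    exact h _ _ _ _ (liftVec_snd_self x v) (liftVec_snd_self x w)
  · intro i _ hi
    have h (a c : TangentSpace (𝓡 (l i)) (x.2 i)) (ha : a = 0) :
        b i x.1 ^ 2 * gF i (x.2 i) a c = 0 := by
      rw [ha]; simp
    exact h _ _ (liftVec_snd_of_ne x v hi)
  · simp

theorem warpedMetric_nabla_liftVec [∀ i, IsManifold (𝓡 (l i)) ∞ (F i)]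
    {gF : ∀ i, MetricField (𝓡 (l i)) (F i)} {b : Fin m → ℝ → ℝ}
    (hgF : ∀ i, IsPseudoRiemannian (𝓡 (l i)) (gF i))
    (hb : ∀ i, ContDiffOn ℝ ∞ (b i) I) (hbpos : ∀ i, ∀ t ∈ I, 0 < b i t)
    (hP : ContMDiff (𝓡 (l r)) (𝓡 (l r)).tangent ∞
      (fun p => (⟨p, P p⟩ : TangentBundle (𝓡 (l r)) (F r))))
    (x : I × ∀ i, F i) (v w : TangentSpace (𝓡 (l r)) (x.2 r)) :
    warpedMetric I b gF x (liftVec r x w)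
        (nabla (warpedModel l) (warpedMetric I b gF) (liftField I r P) x (liftVec r x v))
      = b r x.1 ^ 2 * gF r (x.2 r) w (nabla (𝓡 (l r)) (gF r) P (x.2 r) v) := by
  rw [warpedMetric_nabla hgF hb hbpos hP, liftVec_fst, liftVec_fst]
  have h (a a' c c' : TangentSpace (𝓡 (l r)) (x.2 r)) (ha : a = a') (hc : c = c') :
      -(0 * (b r x.1 * deriv (b r) x.1 * gF r (x.2 r) a (P (x.2 r))))
        + b r x.1 ^ 2 * gF r (x.2 r) c (nabla (𝓡 (l r)) (gF r) P (x.2 r) a)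
        + b r x.1 * deriv (b r) x.1 * 0 * gF r (x.2 r) c (P (x.2 r))
        = b r x.1 ^ 2 * gF r (x.2 r) c' (nabla (𝓡 (l r)) (gF r) P (x.2 r) a') := by
    rw [ha, hc]; ring
  exact h _ _ _ _ (liftVec_snd_self x v) (liftVec_snd_self x w)

end Lift

end QuarterSymmetric
end

/-! ### The main equivalence -/

theorem theorem4p12 {m : ℕ} (l : Fin m → ℕ) (hl : ∀ i, 1 ≤ l i)
    (F : Fin m → Type*) [∀ i, TopologicalSpace (F i)]
    [∀ i, ChartedSpace (EuclideanSpace ℝ (Fin (l i))) (F i)]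
    [∀ i, IsManifold (𝓡 (l i)) ∞ (F i)] [∀ i, Nonempty (F i)]
    (gF : ∀ i, QuarterSymmetric.MetricField (𝓡 (l i)) (F i))
    (hgF : ∀ i, QuarterSymmetric.IsPseudoRiemannian (𝓡 (l i)) (gF i))
    (I : TopologicalSpace.Opens ℝ) (hI : (I : Set ℝ).OrdConnected) (hIne : (I : Set ℝ).Nonempty)
    (b : Fin m → ℝ → ℝ) (hb : ∀ i, ContDiffOn ℝ ∞ (b i) I) (hbpos : ∀ i, ∀ t ∈ I, 0 < b i t)
    (r : Fin m) (P : ∀ p : F r, TangentSpace (𝓡 (l r)) p)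
    (hP : ContMDiff (𝓡 (l r)) (𝓡 (l r)).tangent ∞
      (fun p => (⟨p, P p⟩ : TangentBundle (𝓡 (l r)) (F r))))
    (hPunit : ∀ p, gF r p (P p) (P p) = 1)
    (lam₁ lam₂ : ℝ) (hlam₁ : lam₁ ≠ 0) (hlam₂ : lam₂ ≠ 0)
    (n : ℕ) (hn : n = 1 + ∑ i, l i) (hn2 : 2 < n) (α : ℝ) :
    (∀ (x : I × ∀ i, F i) (u v : TangentSpace (QuarterSymmetric.warpedModel l) x),
      QuarterSymmetric.ricciBar (QuarterSymmetric.warpedModel l) lam₁ lam₂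
          (QuarterSymmetric.warpedMetric I b gF) (QuarterSymmetric.liftField I r P) x u v
        = α * QuarterSymmetric.warpedMetric I b gF x u v) ↔
    ∃ (a : Fin m → ℝ) (β μ₀ μ₁ : ℝ),
      -- the fibers other than `F r` are Einstein, with constants `a i`
      (∀ i, i ≠ r → ∀ (p : F i) (u v : TangentSpace (𝓡 (l i)) p),
        QuarterSymmetric.ricci (𝓡 (l i)) (gF i) p u v = a i * gF i p u v) ∧
      -- `b r` is constant, `∑ l_i b_i'' / b_i` and `div P` are constants with a linear relation
      ((∀ t ∈ I, b r t = β) ∧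
        (∀ t ∈ I, ∑ i, (l i : ℝ) * (deriv (deriv (b i)) t / b i t) = μ₀) ∧
        (∀ p : F r, QuarterSymmetric.divergence (𝓡 (l r)) (gF r) P p = μ₁) ∧
        μ₀ - lam₂ * μ₁ + α = (((n : ℝ) - 1) * lam₁ * lam₂ - lam₂ ^ 2) * β ^ 2) ∧
      -- the identity for the Ricci tensor of `F r`; on the right, `π = g(·, P)`, `g` and `∇` are
      -- those of the product
      (∀ (x : I × ∀ i, F i) (V W : TangentSpace (𝓡 (l r)) (x.2 r)),
        QuarterSymmetric.ricci (𝓡 (l r)) (gF r) (x.2 r) V W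
          + β ^ 2 * ((((n : ℝ) - 1) * lam₁ * lam₂ - lam₂ ^ 2) * β ^ 2 + lam₂ * μ₁ - α)
            * gF r (x.2 r) V W
        = (((n : ℝ) - 1) * lam₁ ^ 2 - lam₂ ^ 2)
            * QuarterSymmetric.warpedMetric I b gF x (QuarterSymmetric.liftVec r x V)
                (QuarterSymmetric.liftField I r P x)
            * QuarterSymmetric.warpedMetric I b gF x (QuarterSymmetric.liftVec r x W)
                (QuarterSymmetric.liftField I r P x)
          - (((n : ℝ) - 1) * lam₁ - lam₂)
            * QuarterSymmetric.warpedMetric I b gF x (QuarterSymmetric.liftVec r x W)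
                (QuarterSymmetric.nabla (QuarterSymmetric.warpedModel l)
                  (QuarterSymmetric.warpedMetric I b gF) (QuarterSymmetric.liftField I r P) x
                  (QuarterSymmetric.liftVec r x V))) ∧
      -- the ordinary differential equations for the other warping functions
      (∀ i, i ≠ r → ∀ t ∈ I,
        a i - b i t * deriv (deriv (b i)) t
          + (((n : ℝ) - 1) * lam₁ * lam₂ - lam₂ ^ 2) * (b i t) ^ 2 * β ^ 2
          - b i t * deriv (b i) t
            * ∑ s ∈ Finset.univ.erase i, (l s : ℝ) * (deriv (b s) t / b s t)
          - ((l i : ℝ) - 1) * (deriv (b i) t) ^ 2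
        = (α - lam₂ * μ₁) * (b i t) ^ 2) := by
  obtain ⟨t₀, ht₀⟩ := hIne
  have hpt (t : I) (i : Fin m) (p : F i) : ∃ x : I × ∀ i, F i, x.1 = t ∧ x.2 i = p :=
    ⟨(t, Function.update (fun i => Classical.arbitrary (F i)) i p), rfl, by simp⟩
  -- Positive dimension enters here: a nonzero metric value lets coefficients of `gF i` be compared.
  have hne (i : Fin m) (p : F i) : ∃ v w, gF i p v w ≠ 0 := by
    by_contra! h
    have : Nonempty (Fin (l i)) := ⟨⟨0, hl i⟩⟩
    obtain ⟨v, hv⟩ := exists_ne (0 : EuclideanSpace ℝ (Fin (l i)))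
    exact hv ((hgF i).nondegenerate p v (h v))
  have key := QuarterSymmetric.ricciBar_warped_eq_iff hgF hb hbpos hP hPunit lam₁ lam₂ hn α
  have hlift (x : I × ∀ i, F i) (V : TangentSpace (𝓡 (l r)) (x.2 r)) :
      QuarterSymmetric.warpedMetric I b gF x (QuarterSymmetric.liftVec r x V)
        (QuarterSymmetric.liftField I r P x) = b r x.1 ^ 2 * gF r (x.2 r) V (P (x.2 r)) :=
    QuarterSymmetric.warpedMetric_liftVec b gF x V (P (x.2 r))
  have hnabla := QuarterSymmetric.warpedMetric_nabla_liftVec hgF hb hbpos hP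
  constructor
  · intro h
    have hE := fun x => (key x).1 (h x)
    set D := QuarterSymmetric.divergence (𝓡 (l r)) (gF r) P with hD
    obtain ⟨p₀⟩ := (inferInstance : Nonempty (F r))
    -- At the fixed time t₀, the point p enters the time equation only through λ₂ D(p).
    have hDconst (p : F r) : D p = D p₀ := by
      obtain ⟨x, hx, rfl⟩ := hpt ⟨t₀, ht₀⟩ r p
      obtain ⟨x', hx', rfl⟩ := hpt ⟨t₀, ht₀⟩ r p₀
      have h1 := (hE x).1
      have h2 := (hE x').1
      rw [hx] at h1
      rw [hx'] at h2
      exact mul_left_cancel₀ hlam₂ (by linarith)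
    simp only [hDconst] at hE
    set K : ℝ := ((n : ℝ) - 1) * lam₁ - lam₂ with hK
    set L : ℝ := ((n : ℝ) - 1) * lam₁ * lam₂ - lam₂ ^ 2 with hL
    have htime (t : ℝ) (ht : t ∈ I) : ∑ i, (l i : ℝ) * (deriv (deriv (b i)) t / b i t)
        = lam₂ * D p₀ + L * b r t ^ 2 - α := by
      obtain ⟨x, hx, -⟩ := hpt ⟨t, ht⟩ r p₀
      have h1 := (hE x).1
      rwa [hx] at h1
    have hfib (i : Fin m) (hi : i ≠ r) (t : ℝ) (ht : t ∈ I) (p : F i)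
        (u v : TangentSpace (𝓡 (l i)) p) : QuarterSymmetric.ricci (𝓡 (l i)) (gF i) p u v
        = (QuarterSymmetric.fiberCoeff l b i t
          + (α - lam₂ * D p₀ - L * b r t ^ 2) * b i t ^ 2) * gF i p u v := by
      obtain ⟨x, hx, rfl⟩ := hpt ⟨t, ht⟩ i p
      have h1 := (hE x).2.2.1 i hi u v
      rw [hx] at h1
      linear_combination h1
    set a : Fin m → ℝ := fun i => QuarterSymmetric.fiberCoeff l b i t₀
      + (α - lam₂ * D p₀ - L * b r t₀ ^ 2) * b i t₀ ^ 2 with ha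
    -- Separation of variables: the Ricci tensor of F_i does not see t, so its proportionality
    -- factor keeps its value at t₀.
    have hconst (i : Fin m) (hi : i ≠ r) (t : ℝ) (ht : t ∈ I) :
        QuarterSymmetric.fiberCoeff l b i t + (α - lam₂ * D p₀ - L * b r t ^ 2) * b i t ^ 2
          = a i := by
      obtain ⟨p⟩ := (inferInstance : Nonempty (F i))
      obtain ⟨v, w, hvw⟩ := hne i p
      exact mul_right_cancel₀ hvw ((hfib i hi t ht p v w).symm.trans (hfib i hi t₀ ht₀ p v w))
    have hn' : (2 : ℝ) < n := by exact_mod_cast hn2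
    have hbr (t : ℝ) (ht : t ∈ I) : deriv (b r) t = 0 := by
      by_cases hK0 : K = 0
      · have hL0 : L = 0 := by linear_combination lam₂ * hK0
        have hc : ((n : ℝ) - 1) * lam₁ ^ 2 - lam₂ ^ 2 ≠ 0 := by
          have h1 : lam₂ = ((n : ℝ) - 1) * lam₁ := by linarith
          have h2 : ((n : ℝ) - 1) * lam₁ ^ 2 - lam₂ ^ 2
              = -(((n : ℝ) - 1) * ((n : ℝ) - 2) * lam₁ ^ 2) := by rw [h1]; ring
          rw [h2]
          exact neg_ne_zero.2 (mul_ne_zero (mul_ne_zero (by linarith) (by linarith))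
            (pow_ne_zero 2 hlam₁))
        -- The F_r equation on (P, P) at p₀: K = 0 removes ∇P, and g(P, P) = 1 turns the π ⊗ π term
        -- into the source c b_r⁴. The constant a_r is the Ricci tensor of F_r on (P, P).
        refine QuarterSymmetric.deriv_eq_zero_of_field_equations (hl r) hb hbpos
          (Function.update a r (QuarterSymmetric.ricci (𝓡 (l r)) (gF r) p₀ (P p₀) (P p₀)))
          (k := α - lam₂ * D p₀) hc ?_ ?_ ?_ ht
        · intro t ht
          rw [htime t ht, hL0]
          ring
        · intro i hi t ht
          rw [Function.update_of_ne hi, ← hconst i hi t ht, hL0]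
          ring
        · intro t ht
          rw [Function.update_self]
          obtain ⟨x, hx, rfl⟩ := hpt ⟨t, ht⟩ r p₀
          have h1 := (hE x).2.2.2 (P (x.2 r)) (P (x.2 r))
          rw [hx, hPunit, hK0, hL0] at h1
          linear_combination h1
      · obtain ⟨x, hx, -⟩ := hpt ⟨t, ht⟩ r p₀
        have h1 := (hE x).2.1
        rw [hx] at h1
        exact (mul_eq_zero.1 ((mul_eq_zero.1 h1).resolve_left hK0)).resolve_left
          (hbpos r t ht).ne'
    obtain ⟨β, hβ⟩ := QuarterSymmetric.exists_eqOn_const hI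
      ((hb r).differentiableOn (by simp)) hbr
    -- The value of μ₀ is dictated by the time equation, which makes the linear relation with μ₁ and
    -- α an identity.
    refine ⟨a, β, lam₂ * D p₀ + L * β ^ 2 - α, D p₀, fun i hi p u v => hfib i hi t₀ ht₀ p u v,
      ⟨hβ, fun t ht => ?_, hDconst, by ring⟩, fun x V W => ?_, fun i hi t ht => ?_⟩
    · rw [htime t ht, hβ t ht]
    -- Every term of the warping coefficient of F_r contains a derivative of the constant function
    -- b_r.
    · have hfc : QuarterSymmetric.fiberCoeff l b r x.1 = 0 := by
        rw [QuarterSymmetric.fiberCoeff, hbr _ x.1.2,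
          QuarterSymmetric.deriv_eq_zero_of_eqOn hbr x.1.2]
        ring
      have h1 := (hE x).2.2.2 V W
      rw [hlift, hlift, hnabla]
      rw [hfc, hβ _ x.1.2] at h1
      rw [hβ _ x.1.2]
      linear_combination h1
    · have h1 := hconst i hi t ht
      rw [hβ t ht, QuarterSymmetric.fiberCoeff] at h1
      linear_combination -h1
  · rintro ⟨a, β, μ₀, μ₁, hEin, ⟨hβ, hμ₀, hμ₁, hμ⟩, hr, hode⟩ x
    have hbr (t : ℝ) (ht : t ∈ I) : deriv (b r) t = 0 :=
      QuarterSymmetric.deriv_eq_zero_of_eqOn hβ ht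
    have hfc : QuarterSymmetric.fiberCoeff l b r x.1 = 0 := by
      rw [QuarterSymmetric.fiberCoeff, hbr _ x.1.2,
        QuarterSymmetric.deriv_eq_zero_of_eqOn hbr x.1.2]
      ring
    refine (key x).2 ⟨?_, ?_, fun i hi u v => ?_, fun u v => ?_⟩
    · rw [hμ₀ _ x.1.2, hμ₁, hβ _ x.1.2]
      linear_combination hμ
    · rw [hbr _ x.1.2]
      ring
    · have h1 := hode i hi x.1 x.1.2
      rw [hEin i hi, hμ₁, hβ _ x.1.2, QuarterSymmetric.fiberCoeff]
      linear_combination gF i (x.2 i) u v * h1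
    · have h1 := hr x u v
      rw [hlift, hlift, hnabla, hβ _ x.1.2] at h1
      rw [hfc, hμ₁, hβ _ x.1.2]
      linear_combination h1
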